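/- Consider the Gaussian wiretap channel $Y^n=X^n+W_b^n$ (legitimate receiver), $Z^n=X^n+W_e^n$ (eavesdropper), where $W_b^n,W_e^n$ are white Gaussian vectors in $\mathbb R^n$ of variance $\sigma_b^2,\sigma_e^2>0$ per dimension, with power $P>0$, $\mathrm{SNR}_b=P/\sigma_b^2$ and $\mathrm{SNR}_e=P/\sigma_e^2$. Logarithms are natural. Definitions. For an $n$-dimensional lattice $\Lambda$ of volume $V(\Lambda)$ and $\sigma>0$, let $f_\sigma(x)=(\sqrt{2\pi}\sigma)^{-n}e^{-\|x\|^2/2\sigma^2}$, let $\gamma_\Lambda(\sigma)=V(\Lambda)^{2/n}/\sigma^2$ be the volume-to-noise ratio, and let $\epsilon_\Lambda(\sigma)=\max_x|V(\Lambda)\sum_{\lambda\in\Lambda}f_\sigma(x-\lambda)-1|$ be the flatness factor. A sequence $\Lambda^{(n)}$ of $n$-dimensional lattices is secrecy-good if, for every fixed volume-to-noise ratio $\gamma_{\Lambda^{(n)}}(\sigma_n)=\gamma<2\pi$, $\epsilon_{\Lambda^{(n)}}(\sigma_n)=e^{-\Omega(n)}$. It is AWGN-good if, for every fixed volume-to-noise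 ratio $\gamma>2\pi e$, the probability that white Gaussian noise of variance $\sigma_n^2$ per dimension falls outside the Voronoi cell of $\Lambda^{(n)}$ is $e^{-\Omega(n)}$. For nested lattices $\Lambda_e\subset\Lambda_b$ in $\mathbb R^n$ and $\sigma_s>0$, the lattice Gaussian code identifies the messages one-to-one with the cosets $\Lambda_e+\lambda_m$ of $\Lambda_e$ in $\Lambda_b$. To send $m$, it transmits $x\in\Lambda_e+\lambda_m$ with probability proportional to $f_{\sigma_s}(x)$. The legitimate receiver decodes $y$ to the coset of a point of $\Lambda_b$ nearest to $\alpha y$, where $\alpha=\sigma_s^2/(\sigma_s^2+\sigma_b^2)$ (MMSE-renormalized lattice decoding). Theorem. Suppose that $\mathrm{SNR}_b>e$ and $\frac{1+\mathrm{SNR}_b}{1+\mathrm{SNR}_e}>e$, and let $$R<\tfrac12\log\min\Big\{\tfrac{1+\mathrm{SNR}_b}{1+\mathrm{SNR}_e},\ \mathrm{SNR}_b\Big\}-\tfrac12 .$$ Let $\Lambda_e^{(n)}\subset\Lambda_b^{(n)}$ be nested $n$-dimensional lattices with $\frac1n\log|\Lambda_b^{(n)}/\Lambda_e^{(n)}|\to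 R$, such that $\Lambda_b^{(n)}$ is AWGN-good and $\Lambda_e^{(n)}$ is secrecy-good. Then there are scaling factors $a_n>0$ such that the lattice Gaussian codes for $a_n\Lambda_e^{(n)}\subset a_n\Lambda_b^{(n)}$ achieve the strong secrecy rate $R$. Precisely, for every choice of $\sigma_{s,n}>0$ with $\sigma_{s,n}^2\to P$ (in particular for $\sigma_{s,n}^2=P$), such codes exist and, however the coset representatives are chosen and ties in the decoder are broken, 1. the rate tends to $R$; 2. $\mathbb P\{\hat{\mathsf M}\ne\mathsf M\}\to0$ and $\mathbb I(\mathsf M;Z^n)\to0$, both uniformly over all message distributions; 3. the power $\frac1n\mathbb E\|X^n\|^2$ of each message is at most $P+o(1)$, uniformly in the message. Moreover, $\sigma_{s,n}$ with $\sigma_{s,n}^2\to P$ can be chosen so that, for all sufficiently large $n$, every message has power at most $P$ exactly. No dither is used. -/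

import Mathlib

open Filter Topology MeasureTheory
open scoped ENNReal Pointwise

noncomputable section

namespace LatticeWiretap

/-- Euclidean space `ℝⁿ`. An `n`-dimensional lattice is a `ℤ`-submodule `Λ` of it that is discrete
and spans `ℝⁿ`, that is, one with `[DiscreteTopology Λ] [IsZLattice ℝ Λ]`; its fundamental volume
`V(Λ)` is `ZLattice.covolume Λ`. -/
abbrev E (n : ℕ) : Type := EuclideanSpace ℝ (Fin n)

/-! ### Gaussians -/

/-- The density `f_{σ,c}` of the Gaussian on `ℝⁿ` with center `c` and variance `σ²` per
dimension. -/
def gaussianDensity {n : ℕ} (σ : ℝ) (c x : E n) : ℝ :=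
  1 / (Real.sqrt (2 * Real.pi) * σ) ^ n * Real.exp (-(‖x - c‖ ^ 2 / (2 * σ ^ 2)))

/-- The law of white Gaussian noise in `ℝⁿ` with variance `σ²` per dimension. -/
def gaussianNoise (n : ℕ) (σ : ℝ) : Measure (E n) :=
  volume.withDensity fun x => ENNReal.ofReal (gaussianDensity σ 0 x)

/-- The `Λ`-periodic function `f_{σ,Λ}(x) = ∑_{λ ∈ Λ} f_{σ,λ}(x)`. -/
def periodicGaussian {n : ℕ} (Λ : Submodule ℤ (E n)) (σ : ℝ) (x : E n) : ℝ :=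
  ∑' l : Λ, gaussianDensity σ (l : E n) x

open Classical in
/-- The discrete Gaussian `D_{Λ-c,σ}` over the shifted lattice `Λ - c`, as a function on `ℝⁿ`
which vanishes off `Λ - c`: `D_{Λ-c,σ}(l - c) = f_σ(l - c) / f_{σ,Λ}(c)` for `l ∈ Λ`. -/
def discreteGaussian {n : ℕ} (Λ : Submodule ℤ (E n)) (c : E n) (σ : ℝ) (x : E n) : ℝ :=
  if x + c ∈ Λ then gaussianDensity σ 0 x / periodicGaussian Λ σ c else 0

/-! ### Lattice parameters and good sequences of lattices -/

/-- The volume-to-noise ratio `γ_Λ(σ) = V(Λ)^{2/n} / σ²`. -/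
def vnr {n : ℕ} (Λ : Submodule ℤ (E n)) (σ : ℝ) : ℝ :=
  ZLattice.covolume Λ ^ (2 / (n : ℝ)) / σ ^ 2

/-- The flatness factor `ε_Λ(σ) = max_x |V(Λ) f_{σ,Λ}(x) - 1|`. As `f_{σ,Λ}` is `Λ`-periodic, the
maximum over a fundamental region is the supremum over `ℝⁿ`. -/
def flatnessFactor {n : ℕ} (Λ : Submodule ℤ (E n)) (σ : ℝ) : ℝ≥0∞ :=
  ⨆ x : E n, ENNReal.ofReal |ZLattice.covolume Λ * periodicGaussian Λ σ x - 1|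

/-- The (closed) Voronoi cell of `Λ`. -/
def voronoiCell {n : ℕ} (Λ : Submodule ℤ (E n)) : Set (E n) :=
  {x | ∀ l ∈ Λ, ‖x‖ ≤ ‖x - l‖}

/-- `u n = e^{-Ω(n)}`. -/
def ExpDecay (u : ℕ → ℝ≥0∞) : Prop :=
  ∃ c : ℝ, 0 < c ∧ ∀ᶠ n : ℕ in atTop, u n ≤ ENNReal.ofReal (Real.exp (-(c * n)))

/-- A sequence of lattices (in dimensions `0, 1, 2, …`) is secrecy-good if, for every fixed
volume-to-noise ratio `γ < 2π`, its flatness factor is `e^{-Ω(n)}`. -/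
def SecrecyGood (Λ : ∀ n : ℕ, Submodule ℤ (E n)) : Prop :=
  ∀ γ : ℝ, 0 < γ → γ < 2 * Real.pi →
    ∀ σ : ℕ → ℝ, (∀ n, 0 < σ n) → (∀ n, vnr (Λ n) (σ n) = γ) →
      ExpDecay fun n => flatnessFactor (Λ n) (σ n)

/-- A sequence of lattices is AWGN-good if, for every fixed volume-to-noise ratio `γ > 2πe`, the
probability that white Gaussian noise leaves the Voronoi cell is `e^{-Ω(n)}`. -/
def AWGNGood (Λ : ∀ n : ℕ, Submodule ℤ (E n)) : Prop :=
  ∀ γ : ℝ, 2 * Real.pi * Real.exp 1 < γ →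
    ∀ σ : ℕ → ℝ, (∀ n, 0 < σ n) → (∀ n, vnr (Λ n) (σ n) = γ) →
      ExpDecay fun n => gaussianNoise n (σ n) (voronoiCell (Λ n))ᶜ

/-! ### Wiretap codes -/

/-- A wiretap code of length `n`: finitely many messages, a randomized encoder (`enc m` is the
law of the channel input `f_n(m, S)`, where `S` is the discrete source of local randomness) and a
decoder for the legitimate receiver. -/
structure WiretapCode (n : ℕ) where
  /-- the number of messages -/
  numMsg : ℕ
  /-- the law of the channel input, for each message -/
  enc : Fin numMsg → PMF (E n)
  /-- the decoder of the legitimate receiver -/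
  dec : E n → Fin numMsg

namespace WiretapCode

variable {n : ℕ} (C : WiretapCode n)

/-- The rate, in nats per dimension. -/
def rate : ℝ := Real.log C.numMsg / n

/-- The transmission power `(1/n) 𝔼‖Xⁿ‖²` of the message `m`. -/
def power (m : Fin C.numMsg) : ℝ≥0∞ :=
  (∑' x : E n, C.enc m x * ENNReal.ofReal (‖x‖ ^ 2)) / n

/-- The law of the output `Xⁿ + Wⁿ` of the additive white Gaussian noise channel with noise
variance `σ²`, given the message `m`. -/
def output (σ : ℝ) (m : Fin C.numMsg) : Measure (E n) :=
  (C.enc m).toMeasure ∗ gaussianNoise n σ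

/-- The probability that the decoded message differs from the message, for the message
distribution `p` and noise variance `σ²` at the legitimate receiver. -/
def errorProb (σ : ℝ) (p : PMF (Fin C.numMsg)) : ℝ≥0∞ :=
  ∑ m, p m * C.output σ m {y | C.dec y ≠ m}

/-- The joint law of the message and of the output of the channel with noise variance `σ²`, for
the message distribution `p`. -/
def joint (σ : ℝ) (p : PMF (Fin C.numMsg)) : Measure (Fin C.numMsg × E n) :=
  ∑ m, p m • (Measure.dirac m).prod (C.output σ m)

/-- The mutual information (in nats) of the message and the output of the channel with noise
variance `σ²`: the Kullback-Leibler divergence of the joint law from the product of its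
marginals. -/
def leakage (σ : ℝ) (p : PMF (Fin C.numMsg)) : ℝ≥0∞ :=
  InformationTheory.klDiv (C.joint σ p) ((C.joint σ p).fst.prod (C.joint σ p).snd)

end WiretapCode

/-- On the Gaussian wiretap channel with noise variances `σb²` (legitimate receiver) and `σe²`
(eavesdropper), the sequence of codes `C` has rate `R`, is reliable, and achieves strong secrecy,
the last two uniformly over all message distributions. -/
structure AchievesStrongSecrecy (σb σe R : ℝ) (C : ∀ n : ℕ, WiretapCode n) : Prop where
  rate : Tendsto (fun n => (C n).rate) atTop (𝓝 R)
  reliability : Tendsto (fun n => ⨆ p, (C n).errorProb σb p) atTop (𝓝 0)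
  secrecy : Tendsto (fun n => ⨆ p, (C n).leakage σe p) atTop (𝓝 0)

/-! ### Lattice Gaussian coding -/

/-- `Q` maps every point to a nearest point of `Λ` (ties are broken arbitrarily). -/
def IsQuantizer {n : ℕ} (Λ : Submodule ℤ (E n)) (Q : E n → E n) : Prop :=
  ∀ x, Q x ∈ Λ ∧ ∀ l ∈ Λ, ‖x - Q x‖ ≤ ‖x - l‖

/-- `C` is a lattice Gaussian code for the nested lattices `Λe ⊆ Λb`. The messages are in
one-to-one correspondence with the cosets of `Λe` in `Λb`, the message `m` with `rep m + Λe`. The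
encoder samples from the discrete Gaussian `D_{Λe + rep m, σs}`. The decoder quantizes `α y` to
`Λb`, where `α = σs² / (σs² + σb²)`, and returns the message of the coset of the result. -/
def IsLatticeGaussianCode {n : ℕ} (Λb Λe : Submodule ℤ (E n)) (σs σb : ℝ)
    (C : WiretapCode n) : Prop :=
  ∃ (rep : Fin C.numMsg → E n) (Q : E n → E n),
    (∀ m, rep m ∈ Λb) ∧
    (∀ l ∈ Λb, ∃! m, l - rep m ∈ Λe) ∧
    (∀ m x, C.enc m x = ENNReal.ofReal (discreteGaussian Λe (-rep m) σs x)) ∧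
    IsQuantizer Λb Q ∧
    ∀ y, Q ((σs ^ 2 / (σs ^ 2 + σb ^ 2)) • y) - rep (C.dec y) ∈ Λe

end LatticeWiretap

end

open LatticeWiretap

/-! Completing the square drives everything: for `r² = s² + t²` and `α = s²/r²`, `f_s(x) f_t(z - x)
= f_r(z) f_{st/r}(x - αz)`. Summed over a coset of `Λe`, it shows that a discrete Gaussian input of
parameter `s` produces an output density `f_r(z)` times a quotient of two Gaussian sums over `Λe`,
of widths `st/r` and `s`. If `Λe` is `ε`-flat at both widths, this quotient lies within a factor `(1
+ ε)/(1 - ε)` of `1`, whatever the message.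

Secrecy: at the eavesdropper all messages thus have output laws comparable to the same Gaussian,
hence to each other with constant `c = ((1 + ε)/(1 - ε))²`, and the divergence is at most `c - 1`
(`klDiv_le_of_le_smul`, `WiretapCode.leakage_le`).

Reliability: the same identity in the variable `e = αy - x` bounds the law of the effective noise of
the MMSE decoder by `(1 + ε)/(1 - ε)` times a Gaussian of standard deviation `sσb/r`, provided `Λe`
is also flat at width `s²/r` (`discreteGaussian_conv_effective_noise_le`). AWGN-goodness of `Λb`
then handles this noise without any dither.

Power: an exponential moment of the discrete Gaussian is a quotient of two Gaussian sums as well,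
and flatness bounds it (`tsum_discreteGaussian_mul_norm_sq_le`).

The rate: with `A = Pσb²/(P + σb²)` the effective noise variance, decoding asks for scaled
`V(Λb)^{2/n} > 2πe A`, and flatness for scaled `V(Λe)^{2/n} < 2π min(P²/(P + σb²), Pσe²/(P + σe²))`.
The two volumes differ asymptotically by the factor `e^{2R}`, and the minimum is `A` times
`min(SNR_b, (1 + SNR_b)/(1 + SNR_e))`; a scaling satisfying both exists exactly when `e^{2R + 1}` is
below the latter minimum. -/

noncomputable section

namespace LatticeWiretap

/-! ### Gaussian densities -/

variable {n : ℕ} {L : Submodule ℤ (E n)}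

lemma gaussianDensity_pos {σ : ℝ} (hσ : 0 < σ) (c x : E n) : 0 < gaussianDensity σ c x := by
  have := Real.pi_pos
  unfold gaussianDensity
  positivity

@[fun_prop]
lemma continuous_gaussianDensity (σ : ℝ) (c : E n) : Continuous (gaussianDensity σ c) := by
  unfold gaussianDensity
  fun_prop

lemma gaussianDensity_eq_zero_sub (σ : ℝ) (c x : E n) :
    gaussianDensity σ c x = gaussianDensity σ 0 (x - c) := by
  simp [gaussianDensity]

lemma gaussianDensity_zero_neg (σ : ℝ) (x : E n) :
    gaussianDensity σ 0 (-x) = gaussianDensity σ 0 x := by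
  simp [gaussianDensity]

lemma gaussianDensity_comm (σ : ℝ) (c x : E n) :
    gaussianDensity σ c x = gaussianDensity σ x c := by
  simp [gaussianDensity, norm_sub_rev]

lemma gaussianDensity_zero_smul {a : ℝ} (ha : a ≠ 0) (σ : ℝ) (x : E n) :
    gaussianDensity (a * σ) 0 (a • x) = (a ^ n)⁻¹ * gaussianDensity σ 0 x := by
  have h : ‖a • x‖ ^ 2 / (2 * (a * σ) ^ 2) = ‖x‖ ^ 2 / (2 * σ ^ 2) := by
    rw [norm_smul, mul_pow, Real.norm_eq_abs, sq_abs, mul_pow,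
      show 2 * (a ^ 2 * σ ^ 2) = a ^ 2 * (2 * σ ^ 2) by ring]
    exact mul_div_mul_left _ _ (pow_ne_zero 2 ha)
  simp only [gaussianDensity, sub_zero, h, one_div]
  rw [show √(2 * Real.pi) * (a * σ) = a * (√(2 * Real.pi) * σ) by ring, mul_pow, mul_inv]
  ring

/-- Completing the square in a product of two Gaussian densities. -/
lemma gaussianDensity_mul {s t r : ℝ} (hs : 0 < s) (ht : 0 < t) (hr : 0 < r)
    (h : r ^ 2 = s ^ 2 + t ^ 2) (x z : E n) :
    gaussianDensity s 0 x * gaussianDensity t 0 (z - x) =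
      gaussianDensity r 0 z * gaussianDensity (s * t / r) 0 (x - (s ^ 2 / r ^ 2) • z) := by
  have hn : ‖x‖ ^ 2 / (2 * s ^ 2) + ‖z - x‖ ^ 2 / (2 * t ^ 2) =
      ‖z‖ ^ 2 / (2 * r ^ 2) + ‖x - (s ^ 2 / r ^ 2) • z‖ ^ 2 / (2 * (s * t / r) ^ 2) := by
    rw [@norm_sub_sq_real _ _ _ z x, @norm_sub_sq_real _ _ _ x, norm_smul, inner_smul_right,
      real_inner_comm z x, mul_pow, Real.norm_eq_abs, sq_abs]
    have h' : t ^ 2 = r ^ 2 - s ^ 2 := by linarith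
    generalize ‖x‖ ^ 2 = X, ‖z‖ ^ 2 = Z, (inner ℝ x z : ℝ) = w
    have e : (s * t / r) ^ 2 = s ^ 2 * t ^ 2 / r ^ 2 := by ring
    have hs2 : s ^ 2 ≠ 0 := by positivity
    have ht2 : t ^ 2 ≠ 0 := by positivity
    have hr2 : r ^ 2 ≠ 0 := by positivity
    rw [e]
    generalize s ^ 2 = S, t ^ 2 = T, r ^ 2 = Q at *
    subst h
    field_simp
    ring
  simp only [gaussianDensity, sub_zero]
  have hc : (√(2 * Real.pi) * s) ^ n * (√(2 * Real.pi) * t) ^ n =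
      (√(2 * Real.pi) * r) ^ n * (√(2 * Real.pi) * (s * t / r)) ^ n := by
    rw [← mul_pow, ← mul_pow]
    congr 1
    field_simp
  calc _ = 1 / ((√(2 * Real.pi) * s) ^ n * (√(2 * Real.pi) * t) ^ n) *
        Real.exp (-(‖x‖ ^ 2 / (2 * s ^ 2) + ‖z - x‖ ^ 2 / (2 * t ^ 2))) := by
        rw [neg_add, Real.exp_add]; ring
    _ = _ := by rw [hc, hn, neg_add, Real.exp_add]; ring

lemma lintegral_gaussianDensity {σ : ℝ} (hσ : 0 < σ) (c : E n) :
    ∫⁻ x, ENNReal.ofReal (gaussianDensity σ c x) = 1 := by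
  have h0 : ∫⁻ x : E n, ENNReal.ofReal (gaussianDensity σ c x) =
      ∫⁻ x : E n, ENNReal.ofReal (gaussianDensity σ 0 x) := by
    simp_rw [gaussianDensity_eq_zero_sub σ c]
    exact lintegral_sub_right_eq_self (fun x => ENNReal.ofReal (gaussianDensity σ 0 x)) c
  have hb : 0 < 1 / (2 * σ ^ 2) := by positivity
  have hpi := Real.pi_pos
  have hI : ∫ x : E n, gaussianDensity σ 0 x = 1 := by
    have := GaussianFourier.integral_rexp_neg_mul_sq_norm (V := E n) hb
    simp only [gaussianDensity, sub_zero, integral_const_mul]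
    have h2 : ∀ x : E n, -(‖x‖ ^ 2 / (2 * σ ^ 2)) = -(1 / (2 * σ ^ 2)) * ‖x‖ ^ 2 :=
      fun x => by ring
    simp_rw [h2, this, finrank_euclideanSpace_fin]
    rw [show Real.pi / (1 / (2 * σ ^ 2)) = (√(2 * Real.pi) * σ) ^ 2 by
      rw [mul_pow, Real.sq_sqrt (by positivity)]; field_simp,
      ← Real.rpow_natCast _ 2, ← Real.rpow_mul (by positivity)]
    rw [show ((2 : ℕ) : ℝ) * ((n : ℝ) / 2) = n by push_cast; ring, Real.rpow_natCast]
    exact one_div_mul_cancel (by positivity)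
  rw [h0, ← ofReal_integral_eq_lintegral_ofReal, hI, ENNReal.ofReal_one]
  -- A non-integrable function has integral `0` by convention, so the value `1` already certifies
  -- integrability.
  · by_contra hcon
    rw [integral_undef hcon] at hI
    exact zero_ne_one hI
  · exact .of_forall fun x => (gaussianDensity_pos hσ 0 x).le

/-- The convolution of two Gaussian densities. -/
lemma lintegral_gaussianDensity_mul {s t r : ℝ} (hs : 0 < s) (ht : 0 < t) (hr : 0 < r)
    (h : r ^ 2 = s ^ 2 + t ^ 2) (z : E n) :
    ∫⁻ x, ENNReal.ofReal (gaussianDensity s 0 x) * ENNReal.ofReal (gaussianDensity t 0 (z - x)) =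
      ENNReal.ofReal (gaussianDensity r 0 z) := by
  simp_rw [← ENNReal.ofReal_mul (gaussianDensity_pos hs 0 _).le, gaussianDensity_mul hs ht hr h,
    ENNReal.ofReal_mul (gaussianDensity_pos hr 0 _).le, ← gaussianDensity_eq_zero_sub]
  rw [lintegral_const_mul _ (by fun_prop), lintegral_gaussianDensity (by positivity), mul_one]

lemma gaussianNoise_apply (σ : ℝ) (S : Set (E n)) (hS : MeasurableSet S) :
    gaussianNoise n σ S = ∫⁻ x in S, ENNReal.ofReal (gaussianDensity σ 0 x) :=
  withDensity_apply _ hS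

instance sFinite_gaussianNoise (σ : ℝ) : SFinite (gaussianNoise n σ) := by
  unfold gaussianNoise; infer_instance

lemma isProbabilityMeasure_gaussianNoise {σ : ℝ} (hσ : 0 < σ) :
    IsProbabilityMeasure (gaussianNoise n σ) :=
  ⟨by rw [gaussianNoise_apply _ _ .univ, setLIntegral_univ, lintegral_gaussianDensity hσ]⟩

lemma lintegral_comp_smul_sub {a : ℝ} (ha : 0 < a) (c : E n) {f : E n → ℝ≥0∞}
    (hf : Measurable f) :
    ∫⁻ x, f (a • x - c) = ENNReal.ofReal ((a ^ n)⁻¹) * ∫⁻ x, f x := by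
  rw [← lintegral_sub_right_eq_self f c]
  have := Measure.map_addHaar_smul (volume : Measure (E n)) ha.ne'
  rw [finrank_euclideanSpace_fin, abs_of_pos (by positivity)] at this
  rw [← smul_eq_mul, ← lintegral_smul_measure, ← this, lintegral_map (by fun_prop) (by fun_prop)]

lemma gaussianNoise_mul_apply {t σ : ℝ} (ht : 0 < t) {S : Set (E n)} (hS : MeasurableSet S) :
    gaussianNoise n (t * σ) S = gaussianNoise n σ {x | t • x ∈ S} := by
  have hS' : MeasurableSet {x : E n | t • x ∈ S} := measurableSet_preimage (by fun_prop) hS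
  rw [gaussianNoise_apply _ _ hS, gaussianNoise_apply _ _ hS', ← lintegral_indicator hS,
    ← lintegral_indicator hS']
  have hm : Measurable (S.indicator fun x => ENNReal.ofReal (gaussianDensity (t * σ) 0 x)) :=
    Measurable.indicator (by fun_prop) hS
  have key := lintegral_comp_smul_sub ht 0 hm
  have hpt : ∀ x : E n, S.indicator (fun x => ENNReal.ofReal (gaussianDensity (t * σ) 0 x))
      (t • x - 0) = ENNReal.ofReal ((t ^ n)⁻¹) *
        {x | t • x ∈ S}.indicator (fun x => ENNReal.ofReal (gaussianDensity σ 0 x)) x := by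
    intro x
    by_cases hx : t • x ∈ S
    · rw [sub_zero, Set.indicator_of_mem hx, Set.indicator_of_mem (by exact hx),
        gaussianDensity_zero_smul ht.ne', ENNReal.ofReal_mul (by positivity)]
    · rw [sub_zero, Set.indicator_of_notMem hx, Set.indicator_of_notMem (by exact hx), mul_zero]
  simp_rw [hpt] at key
  rw [lintegral_const_mul _ (Measurable.indicator (by fun_prop) hS')] at key
  refine ((ENNReal.mul_right_inj ?_ ENNReal.ofReal_ne_top).1 key).symm
  simpa using by positivity

/-! ### Gaussian sums over lattices -/

lemma countable_of_discreteTopology (L : Submodule ℤ (E n)) [DiscreteTopology L] : Countable L :=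
  TopologicalSpace.separableSpace_iff_countable.1 inferInstance

/-- Inverts `v ^ k / k! ≤ exp v` at `v = u² / b`; the polynomial decay is what makes Gaussian sums
over a lattice comparable to a convergent series of inverse powers of the norm. -/
lemma exp_neg_sq_le {b u : ℝ} (hb : 0 < b) (hu : u ≠ 0) (k : ℕ) :
    Real.exp (-(u ^ 2 / b)) ≤ (b ^ k * k.factorial) * u⁻¹ ^ (2 * k) := by
  have h := Real.pow_div_factorial_le_exp (u ^ 2 / b) (by positivity) k
  have hu2 : 0 < u ^ 2 := by positivity
  have hp : 0 < (u ^ 2 / b) ^ k / k.factorial := by positivity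
  rw [Real.exp_neg]
  refine (inv_anti₀ hp h).trans_eq ?_
  rw [div_pow, inv_pow, pow_mul]
  field_simp

lemma summable_gaussianDensity (L : Submodule ℤ (E n)) [DiscreteTopology L] {σ : ℝ} (hσ : 0 < σ)
    (x : E n) : Summable fun l : L => gaussianDensity σ (l : E n) x := by
  -- The inverse powers of order `2k` are summable once `2k` exceeds the rank. The bound fails at `l
  -- = x`, where the inverse is `0`, so that one point is discarded.
  set k := Module.finrank ℤ L + 1
  have hs := (ZLattice.summable_norm_sub_inv_pow L (2 * k) (by omega) x).mul_left
    (1 / (√(2 * Real.pi) * σ) ^ n * ((2 * σ ^ 2) ^ k * k.factorial))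
  have hpi := Real.pi_pos
  refine Summable.of_norm_bounded_eventually hs ?_
  have hfin : {l : L | (l : E n) = x}.Finite :=
    Set.Subsingleton.finite fun l hl l' hl' => Subtype.ext (hl.trans hl'.symm)
  filter_upwards [hfin.compl_mem_cofinite] with l hl
  have hl' : ‖(l : E n) - x‖ ≠ 0 := by
    rw [norm_ne_zero_iff, sub_ne_zero]; exact hl
  rw [Real.norm_of_nonneg (gaussianDensity_pos hσ _ _).le, gaussianDensity, norm_sub_rev,
    mul_assoc]
  gcongr
  exact exp_neg_sq_le (by positivity) hl' k

lemma ofReal_periodicGaussian (L : Submodule ℤ (E n)) [DiscreteTopology L] {σ : ℝ} (hσ : 0 < σ)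
    (x : E n) : ENNReal.ofReal (periodicGaussian L σ x) =
      ∑' l : L, ENNReal.ofReal (gaussianDensity σ (l : E n) x) :=
  ENNReal.ofReal_tsum_of_nonneg (fun _ => (gaussianDensity_pos hσ _ _).le)
    (summable_gaussianDensity L hσ x)

lemma periodicGaussian_pos (L : Submodule ℤ (E n)) [DiscreteTopology L] {σ : ℝ} (hσ : 0 < σ)
    (x : E n) : 0 < periodicGaussian L σ x :=
  (summable_gaussianDensity L hσ x).tsum_pos (fun _ => (gaussianDensity_pos hσ _ _).le) 0
    (gaussianDensity_pos hσ _ _)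

lemma measurable_ofReal_periodicGaussian (L : Submodule ℤ (E n)) [DiscreteTopology L] {σ : ℝ}
    (hσ : 0 < σ) : Measurable fun x => ENNReal.ofReal (periodicGaussian L σ x) := by
  have := countable_of_discreteTopology L
  simp_rw [ofReal_periodicGaussian L hσ]
  exact Measurable.tsum fun l => by fun_prop

/-- The identity `f_r = f_s * f_t`, translated to each lattice point and summed. -/
lemma ofReal_periodicGaussian_eq_lintegral (L : Submodule ℤ (E n)) [DiscreteTopology L]
    {s t r : ℝ} (hs : 0 < s) (ht : 0 < t) (hr : 0 < r) (h : r ^ 2 = s ^ 2 + t ^ 2) (x : E n) :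
    ENNReal.ofReal (periodicGaussian L r x) =
      ∫⁻ y, ENNReal.ofReal (periodicGaussian L s y) *
        ENNReal.ofReal (gaussianDensity t 0 (x - y)) := by
  have := countable_of_discreteTopology L
  simp_rw [ofReal_periodicGaussian L hs, ofReal_periodicGaussian L hr, ← ENNReal.tsum_mul_right]
  rw [lintegral_tsum fun l => by fun_prop]
  congr 1 with l
  rw [← lintegral_add_right_eq_self _ (l : E n)]
  have e (y : E n) : gaussianDensity s (l : E n) (y + l) = gaussianDensity s 0 y := by
    rw [gaussianDensity_eq_zero_sub, add_sub_cancel_right]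
  simp_rw [e, gaussianDensity_eq_zero_sub r (l : E n), sub_add_eq_sub_sub_swap]
  exact (lintegral_gaussianDensity_mul hs ht hr h _).symm

/-- The Gaussian sum of width `σ` over `L`, normalized by `K`, is within `ε` of `1`. -/
def IsFlat (L : Submodule ℤ (E n)) (K σ ε : ℝ) : Prop :=
  ∀ x, |K * periodicGaussian L σ x - 1| ≤ ε

lemma IsFlat.le_one_add {K σ ε : ℝ} (h : IsFlat L K σ ε) (x : E n) :
    K * periodicGaussian L σ x ≤ 1 + ε := by
  linarith [(abs_le.1 (h x)).2]

lemma IsFlat.one_sub_le {K σ ε : ℝ} (h : IsFlat L K σ ε) (x : E n) :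
    1 - ε ≤ K * periodicGaussian L σ x := by
  linarith [(abs_le.1 (h x)).1]

lemma lintegral_gaussianDensity_sub {t : ℝ} (ht : 0 < t) (x : E n) :
    ∫⁻ y, ENNReal.ofReal (gaussianDensity t 0 (x - y)) = 1 := by
  simp_rw [← gaussianDensity_eq_zero_sub, gaussianDensity_comm t _ x]
  exact lintegral_gaussianDensity ht x

/-- Flatness is inherited by wider Gaussians. -/
lemma IsFlat.mono [DiscreteTopology L] {K s r ε : ℝ} (hK : 0 < K) (hs : 0 < s) (hsr : s < r)
    (h : IsFlat L K s ε) : IsFlat L K r ε := by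
  intro x
  have hr := hs.trans hsr
  have hε0 : 0 ≤ ε := (abs_nonneg _).trans (h 0)
  set t := √(r ^ 2 - s ^ 2)
  have hd : 0 < r ^ 2 - s ^ 2 := by nlinarith
  have ht : 0 < t := Real.sqrt_pos.2 hd
  have hrt : r ^ 2 = s ^ 2 + t ^ 2 := by rw [Real.sq_sqrt hd.le]; ring
  -- The wider sum is an average of the narrower one against a probability density, so it stays
  -- within the same bounds `1 ± ε`.
  have hrep : ENNReal.ofReal (K * periodicGaussian L r x) =
      ∫⁻ y, ENNReal.ofReal (K * periodicGaussian L s y) *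
        ENNReal.ofReal (gaussianDensity t 0 (x - y)) := by
    simp_rw [ENNReal.ofReal_mul hK.le, mul_assoc]
    have hm : Measurable fun y => ENNReal.ofReal (periodicGaussian L s y) *
        ENNReal.ofReal (gaussianDensity t 0 (x - y)) :=
      (measurable_ofReal_periodicGaussian L hs).mul (by fun_prop)
    rw [lintegral_const_mul _ hm, ofReal_periodicGaussian_eq_lintegral L hs ht hr hrt]
  have hc (c : ℝ≥0∞) : ∫⁻ y, c * ENNReal.ofReal (gaussianDensity t 0 (x - y)) = c := by
    rw [lintegral_const_mul _ (by fun_prop), lintegral_gaussianDensity_sub ht, mul_one]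
  have hup : ENNReal.ofReal (K * periodicGaussian L r x) ≤ ENNReal.ofReal (1 + ε) := by
    rw [hrep, ← hc (ENNReal.ofReal (1 + ε))]
    gcongr with y
    exact h.le_one_add y
  have hlo : ENNReal.ofReal (1 - ε) ≤ ENNReal.ofReal (K * periodicGaussian L r x) := by
    rw [hrep, ← hc (ENNReal.ofReal (1 - ε))]
    gcongr with y
    exact h.one_sub_le y
  have h1 := (ENNReal.ofReal_le_ofReal_iff (by linarith)).1 hup
  have h2 := (ENNReal.ofReal_le_ofReal_iff
    (mul_pos hK (periodicGaussian_pos L hr x)).le).1 hlo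
  rw [abs_le]
  constructor <;> linarith

/-- For a flat lattice, the values of Gaussian sums differ by a factor at most
`(1 + ε) / (1 - ε)`. -/
lemma IsFlat.periodicGaussian_le {K s r ε : ℝ} (hK : 0 < K) (hε : ε < 1)
    (h : IsFlat L K s ε) (h' : IsFlat L K r ε) (x y : E n) :
    periodicGaussian L s x ≤ (1 + ε) / (1 - ε) * periodicGaussian L r y := by
  have hε' : 0 < 1 - ε := by linarith
  have h1 := h.le_one_add x
  have h2 := h'.one_sub_le y
  have hε0 : 0 ≤ 1 + ε := by linarith [(abs_nonneg _).trans (h 0)]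
  rw [div_mul_eq_mul_div, le_div_iff₀ hε']
  refine le_of_mul_le_mul_left ?_ hK
  nlinarith

instance discreteTopology_smul (a : ℝ) (L : Submodule ℤ (E n)) [DiscreteTopology L] :
    DiscreteTopology ↥(a • L) := by
  rcases eq_or_ne a 0 with rfl | ha
  · have : Subsingleton ↥((0 : ℝ) • L) := by
      refine ⟨fun x y => Subtype.ext ?_⟩
      obtain ⟨_, h⟩ := x
      obtain ⟨_, h'⟩ := y
      rw [Submodule.mem_smul_pointwise_iff_exists] at h h'
      obtain ⟨_, _, rfl⟩ := h
      obtain ⟨_, _, rfl⟩ := h'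
      simp
    infer_instance
  · exact ((Homeomorph.smulOfNeZero a ha).image
      (L : Set (E n))).symm.isInducing.isEmbedding.discreteTopology

lemma mem_smul_iff {a : ℝ} (ha : a ≠ 0) (L : Submodule ℤ (E n)) (x : E n) :
    x ∈ a • L ↔ a⁻¹ • x ∈ L := by
  rw [Submodule.mem_smul_pointwise_iff_exists]
  constructor
  · rintro ⟨y, hy, rfl⟩
    rwa [inv_smul_smul₀ ha]
  · exact fun h => ⟨_, h, smul_inv_smul₀ ha x⟩

/-- Multiplication by `a ≠ 0` as a bijection of `L` with `a • L`. -/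
def smulEquiv {a : ℝ} (ha : a ≠ 0) (L : Submodule ℤ (E n)) : L ≃ ↥(a • L) where
  toFun l := ⟨a • (l : E n), Submodule.smul_mem_pointwise_smul _ _ _ l.2⟩
  invFun l := ⟨a⁻¹ • (l : E n), (mem_smul_iff ha L _).1 l.2⟩
  left_inv _ := Subtype.ext (inv_smul_smul₀ ha _)
  right_inv _ := Subtype.ext (smul_inv_smul₀ ha _)

lemma periodicGaussian_smul {a : ℝ} (ha : a ≠ 0) (L : Submodule ℤ (E n)) (σ : ℝ) (x : E n) :
    periodicGaussian (a • L) (a * σ) x = (a ^ n)⁻¹ * periodicGaussian L σ (a⁻¹ • x) := by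
  rw [periodicGaussian, periodicGaussian, ← tsum_mul_left, ← (smulEquiv ha L).tsum_eq]
  congr 1 with l
  rw [gaussianDensity_eq_zero_sub, gaussianDensity_eq_zero_sub σ,
    ← gaussianDensity_zero_smul ha, smul_sub, smul_inv_smul₀ ha]
  rfl

/-- Since `K` is a free parameter, it absorbs the factor `a ^ n` by which the Gaussian sum shrinks;
the covolume of `a • L` never has to be computed. -/
lemma IsFlat.smul {K σ ε a : ℝ} (ha : 0 < a) (h : IsFlat L K σ ε) :
    IsFlat (a • L) (a ^ n * K) (a * σ) ε := by
  intro x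
  have : a ^ n ≠ 0 := by positivity
  rw [periodicGaussian_smul ha.ne', mul_right_comm, mul_inv_cancel_left₀ this, mul_comm]
  exact h _

/-- A sum over a coset of `L`. -/
lemma tsum_eq_tsum_sub (L : Submodule ℤ (E n)) (c : E n) {F : E n → ℝ≥0∞}
    (hF : ∀ x, x + c ∉ L → F x = 0) : ∑' x, F x = ∑' l : L, F (l - c) := by
  refine (Function.Injective.tsum_eq (g := fun l : L => (l : E n) - c) (fun l l' h => ?_) ?_).symm
  · exact Subtype.ext (sub_left_injective h)
  · intro x hx
    by_cases hxc : x + c ∈ L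
    · exact ⟨⟨x + c, hxc⟩, add_sub_cancel_right x c⟩
    · exact absurd (hF x hxc) hx

lemma discreteGaussian_sub (L : Submodule ℤ (E n)) (c : E n) (σ : ℝ) (l : L) :
    discreteGaussian L c σ (l - c) = gaussianDensity σ l c / periodicGaussian L σ c := by
  rw [discreteGaussian, sub_add_cancel, if_pos l.2, ← gaussianDensity_eq_zero_sub,
    gaussianDensity_comm]

lemma discreteGaussian_of_notMem {c x : E n} (h : x + c ∉ L) (σ : ℝ) :
    discreteGaussian L c σ x = 0 :=
  if_neg h

/-- The sum of a function against the discrete Gaussian. -/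
lemma tsum_discreteGaussian_mul (L : Submodule ℤ (E n)) [DiscreteTopology L] (c : E n) {σ : ℝ}
    (hσ : 0 < σ) (F : E n → ℝ≥0∞) :
    ∑' x, ENNReal.ofReal (discreteGaussian L c σ x) * F x =
      (ENNReal.ofReal (periodicGaussian L σ c))⁻¹ *
        ∑' l : L, ENNReal.ofReal (gaussianDensity σ 0 ((l : E n) - c)) * F ((l : E n) - c) := by
  rw [tsum_eq_tsum_sub L c fun x hx => by rw [discreteGaussian_of_notMem hx]; simp,
    ← ENNReal.tsum_mul_left]
  congr 1 with l
  rw [discreteGaussian_sub, ENNReal.ofReal_div_of_pos (periodicGaussian_pos L hσ c),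
    div_eq_mul_inv, gaussianDensity_comm, gaussianDensity_eq_zero_sub]
  ring

lemma tsum_ofReal_gaussianDensity_sub (L : Submodule ℤ (E n)) [DiscreteTopology L] {σ : ℝ}
    (hσ : 0 < σ) (c : E n) :
    ∑' l : L, ENNReal.ofReal (gaussianDensity σ 0 ((l : E n) - c)) =
      ENNReal.ofReal (periodicGaussian L σ c) := by
  simp_rw [ofReal_periodicGaussian L hσ, ← gaussianDensity_eq_zero_sub, gaussianDensity_comm σ c]

lemma tsum_discreteGaussian (L : Submodule ℤ (E n)) [DiscreteTopology L] (c : E n) {σ : ℝ}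
    (hσ : 0 < σ) : ∑' x, ENNReal.ofReal (discreteGaussian L c σ x) = 1 := by
  have h := tsum_discreteGaussian_mul L c hσ fun _ => 1
  simp only [mul_one] at h
  rw [h, tsum_ofReal_gaussianDensity_sub L hσ]
  exact ENNReal.inv_mul_cancel (by simpa using periodicGaussian_pos L hσ c) ENNReal.ofReal_ne_top

/-! ### Discrete Gaussian inputs to the Gaussian channel -/

/-- A `PMF` has countable support even on an uncountable type, which is why no measurability of `f`
is needed. -/
lemma lintegral_toMeasure_eq_tsum {X : Type*} [MeasurableSpace X] [MeasurableSingletonClass X]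
    (p : PMF X) {f : X → ℝ≥0∞} : ∫⁻ x, f x ∂p.toMeasure = ∑' x, p x * f x := by
  have hc : p.support.Countable := p.support_countable
  rw [← p.restrict_toMeasure_support, lintegral_countable f hc]
  rw [← tsum_subtype_eq_of_support_subset (s := p.support)
    (f := fun x => p x * f x) fun x hx => left_ne_zero_of_mul hx]
  congr 1 with x
  rw [p.toMeasure_apply_singleton _ (measurableSet_singleton _), mul_comm]

lemma toMeasure_conv_gaussianNoise_apply (p : PMF (E n)) (t : ℝ) {S : Set (E n)}
    (hS : MeasurableSet S) :
    (p.toMeasure ∗ gaussianNoise n t) S =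
      ∑' x, p x * ∫⁻ y in S, ENNReal.ofReal (gaussianDensity t 0 (y - x)) := by
  rw [← lintegral_indicator_one hS, Measure.lintegral_conv (by measurability),
    lintegral_toMeasure_eq_tsum]
  congr 1 with x
  congr 1
  have hm : Measurable fun y : E n => ENNReal.ofReal (gaussianDensity t 0 y) := by fun_prop
  have hm' : Measurable fun y => S.indicator (1 : E n → ℝ≥0∞) (x + y) :=
    (measurable_const.indicator hS).comp (measurable_const_add x)
  rw [gaussianNoise, lintegral_withDensity_eq_lintegral_mul _ hm hm',
    ← lintegral_indicator hS, ← lintegral_add_left_eq_self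
      (S.indicator fun y => ENNReal.ofReal (gaussianDensity t 0 (y - x))) x]
  congr 1 with y
  by_cases hy : x + y ∈ S <;> simp [hy]

/-- The law of the output of the Gaussian channel, for a discrete Gaussian input. -/
lemma discreteGaussian_conv_apply [DiscreteTopology L] {s : ℝ} (hs : 0 < s) {c : E n}
    {p : PMF (E n)} (hp : ∀ x, p x = ENNReal.ofReal (discreteGaussian L c s x)) (t : ℝ)
    {S : Set (E n)} (hS : MeasurableSet S) :
    (p.toMeasure ∗ gaussianNoise n t) S = (ENNReal.ofReal (periodicGaussian L s c))⁻¹ *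
      ∑' l : L, ∫⁻ y in S, ENNReal.ofReal (gaussianDensity s 0 ((l : E n) - c) *
        gaussianDensity t 0 (y - ((l : E n) - c))) := by
  rw [toMeasure_conv_gaussianNoise_apply p t hS]
  simp_rw [hp]
  rw [tsum_discreteGaussian_mul L c hs]
  congr 2 with l
  rw [← lintegral_const_mul _ (by fun_prop)]
  simp_rw [ENNReal.ofReal_mul (gaussianDensity_pos hs _ _).le]

/-- Completing the square moves all dependence on the message `c` into a quotient of Gaussian sums,
the only thing flatness has to control. -/
lemma discreteGaussian_conv_eq_setLIntegral [DiscreteTopology L] {s t r : ℝ} (hs : 0 < s)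
    (ht : 0 < t) (hr : 0 < r) (h : r ^ 2 = s ^ 2 + t ^ 2) {c : E n} {p : PMF (E n)}
    (hp : ∀ x, p x = ENNReal.ofReal (discreteGaussian L c s x)) {S : Set (E n)}
    (hS : MeasurableSet S) :
    (p.toMeasure ∗ gaussianNoise n t) S =
      ∫⁻ y in S, ENNReal.ofReal (gaussianDensity r 0 y) *
        ((ENNReal.ofReal (periodicGaussian L s c))⁻¹ *
          ENNReal.ofReal (periodicGaussian L (s * t / r) (c + (s ^ 2 / r ^ 2) • y))) := by
  have := countable_of_discreteTopology L
  have hu : 0 < s * t / r := by positivity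
  rw [discreteGaussian_conv_apply hs hp t hS, ← lintegral_tsum fun l => by fun_prop,
    ← lintegral_const_mul _ (Measurable.tsum fun l => by fun_prop)]
  refine lintegral_congr fun y => ?_
  rw [← tsum_ofReal_gaussianDensity_sub L hu, mul_left_comm,
    ← ENNReal.tsum_mul_left (a := ENNReal.ofReal (gaussianDensity r 0 y))]
  congr 1
  refine tsum_congr fun l => ?_
  rw [gaussianDensity_mul hs ht hr h, ENNReal.ofReal_mul (gaussianDensity_pos hr _ _).le, sub_sub]

lemma IsFlat.inv_mul_ofReal_le [DiscreteTopology L] {K s u ε : ℝ} (hK : 0 < K) (hs : 0 < s)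
    (hε : ε < 1) (h : IsFlat L K s ε) (h' : IsFlat L K u ε) (x y : E n) :
    (ENNReal.ofReal (periodicGaussian L s x))⁻¹ * ENNReal.ofReal (periodicGaussian L u y) ≤
      ENNReal.ofReal ((1 + ε) / (1 - ε)) := by
  have hpos := periodicGaussian_pos L hs x
  rw [← ENNReal.ofReal_inv_of_pos hpos, ← ENNReal.ofReal_mul (by positivity)]
  apply ENNReal.ofReal_le_ofReal
  rw [inv_mul_le_iff₀ hpos, mul_comm]
  exact h'.periodicGaussian_le hK hε h y x

lemma IsFlat.one_le_mul_inv_mul_ofReal [DiscreteTopology L] {K s u ε : ℝ} (hK : 0 < K)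
    (hs : 0 < s) (hu : 0 < u) (hε : ε < 1) (h : IsFlat L K s ε) (h' : IsFlat L K u ε)
    (x y : E n) :
    1 ≤ ENNReal.ofReal ((1 + ε) / (1 - ε)) *
      ((ENNReal.ofReal (periodicGaussian L s x))⁻¹ * ENNReal.ofReal (periodicGaussian L u y)) := by
  have hpos := periodicGaussian_pos L hs x
  have hpos' := periodicGaussian_pos L hu y
  have hε0 : 0 ≤ ε := (abs_nonneg _).trans (h 0)
  rw [← ENNReal.ofReal_inv_of_pos hpos, ← ENNReal.ofReal_mul (by positivity),
    ← ENNReal.ofReal_mul (div_nonneg (by linarith) (by linarith)), ENNReal.one_le_ofReal,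
    mul_left_comm, le_inv_mul_iff₀ hpos, mul_one]
  exact h.periodicGaussian_le hK hε h' x y

/-- This bound and the reverse one below use a Gaussian that does not depend on `c`; through it any
two messages are compared. -/
lemma discreteGaussian_conv_le [DiscreteTopology L] {K ε s t r : ℝ} (hK : 0 < K) (hε : ε < 1)
    (hs : 0 < s) (ht : 0 < t) (hr : 0 < r) (h : r ^ 2 = s ^ 2 + t ^ 2)
    (hfs : IsFlat L K s ε) (hfu : IsFlat L K (s * t / r) ε) {c : E n} {p : PMF (E n)}
    (hp : ∀ x, p x = ENNReal.ofReal (discreteGaussian L c s x)) :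
    p.toMeasure ∗ gaussianNoise n t ≤ ENNReal.ofReal ((1 + ε) / (1 - ε)) • gaussianNoise n r := by
  refine Measure.le_iff.2 fun S hS => ?_
  rw [discreteGaussian_conv_eq_setLIntegral hs ht hr h hp hS, Measure.smul_apply, smul_eq_mul,
    gaussianNoise_apply _ _ hS, ← lintegral_const_mul' _ _ ENNReal.ofReal_ne_top]
  refine lintegral_mono fun y => ?_
  rw [mul_comm (ENNReal.ofReal ((1 + ε) / (1 - ε)))]
  gcongr
  exact hfs.inv_mul_ofReal_le hK hs hε hfu _ _

lemma le_discreteGaussian_conv [DiscreteTopology L] {K ε s t r : ℝ} (hK : 0 < K) (hε : ε < 1)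
    (hs : 0 < s) (ht : 0 < t) (hr : 0 < r) (h : r ^ 2 = s ^ 2 + t ^ 2)
    (hfs : IsFlat L K s ε) (hfu : IsFlat L K (s * t / r) ε) {c : E n} {p : PMF (E n)}
    (hp : ∀ x, p x = ENNReal.ofReal (discreteGaussian L c s x)) :
    gaussianNoise n r ≤
      ENNReal.ofReal ((1 + ε) / (1 - ε)) • (p.toMeasure ∗ gaussianNoise n t) := by
  refine Measure.le_iff.2 fun S hS => ?_
  rw [Measure.smul_apply, discreteGaussian_conv_eq_setLIntegral hs ht hr h hp hS, smul_eq_mul,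
    gaussianNoise_apply _ _ hS, ← lintegral_const_mul' _ _ ENNReal.ofReal_ne_top]
  refine lintegral_mono fun y => ?_
  rw [mul_left_comm]
  exact le_mul_of_one_le_right' (hfs.one_le_mul_inv_mul_ofReal hK hs (by positivity) hε hfu _ _)

/-! ### Information leakage -/

/-- The density `g = dμ/dν` is at most `c`, so `g log g ≤ g (g - 1) ≤ g (c - 1)`, and `g` integrates
to `1`. -/
lemma klDiv_le_of_le_smul {X : Type*} [MeasurableSpace X] {μ ν : Measure X}
    [IsProbabilityMeasure μ] [IsProbabilityMeasure ν] {c : ℝ} (hc : 1 ≤ c)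
    (h : μ ≤ ENNReal.ofReal c • ν) : InformationTheory.klDiv μ ν ≤ ENNReal.ofReal (c - 1) := by
  have hac : μ ≪ ν := (Measure.absolutelyContinuous_of_le h).trans
    (Measure.smul_absolutelyContinuous)
  have hbd : ∀ᵐ x ∂ν, μ.rnDeriv ν x ≤ ENNReal.ofReal c := by
    refine ae_le_of_forall_setLIntegral_le_of_sigmaFinite (Measure.measurable_rnDeriv μ ν)
      fun s _ _ => ?_
    rw [setLIntegral_const]
    exact (Measure.setLIntegral_rnDeriv_le s).trans (h s)
  have hone : ∫⁻ x, μ.rnDeriv ν x ∂ν = 1 := by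
    rw [Measure.lintegral_rnDeriv hac, measure_univ]
  rw [InformationTheory.klDiv_eq_lintegral_klFun_of_ac hac]
  -- Adding `1 = ∫ g dν` to both sides cancels the `-g` in `klFun g = g log g + 1 - g`, so nothing
  -- is subtracted in `ℝ≥0∞`.
  refine ENNReal.le_of_add_le_add_right ENNReal.one_ne_top ?_
  calc ∫⁻ x, ENNReal.ofReal (InformationTheory.klFun (μ.rnDeriv ν x).toReal) ∂ν + 1
      = ∫⁻ x, (ENNReal.ofReal (InformationTheory.klFun (μ.rnDeriv ν x).toReal) +
          μ.rnDeriv ν x) ∂ν := by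
        rw [lintegral_add_right _ (Measure.measurable_rnDeriv μ ν), hone]
    _ ≤ ∫⁻ x, (ENNReal.ofReal (c - 1) * μ.rnDeriv ν x + 1) ∂ν := by
        refine lintegral_mono_ae (hbd.mono fun x hx => ?_)
        have htop : μ.rnDeriv ν x ≠ ∞ := ne_top_of_le_ne_top ENNReal.ofReal_ne_top hx
        generalize μ.rnDeriv ν x = g at hx htop
        lift g to NNReal using htop
        have hg : (g : ℝ) ≤ c := by
          rw [← ENNReal.ofReal_coe_nnreal] at hx
          exact (ENNReal.ofReal_le_ofReal_iff (by linarith)).1 hx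
        have hg0 : (0 : ℝ) ≤ g := g.2
        rw [ENNReal.coe_toReal, ← ENNReal.ofReal_coe_nnreal,
          ← ENNReal.ofReal_add (InformationTheory.klFun_nonneg hg0) hg0,
          ← ENNReal.ofReal_mul (by linarith), ← ENNReal.ofReal_one,
          ← ENNReal.ofReal_add (mul_nonneg (by linarith) hg0) zero_le_one]
        apply ENNReal.ofReal_le_ofReal
        rw [InformationTheory.klFun]
        have hlog : (g : ℝ) * Real.log g ≤ g * (c - 1) := by
          rcases hg0.eq_or_lt with h0 | h0
          · rw [← h0]; simp
          · gcongr
            linarith [Real.log_le_sub_one_of_pos h0]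
        linarith
    _ = ENNReal.ofReal (c - 1) + 1 := by
        rw [lintegral_add_right _ measurable_const,
          lintegral_const_mul _ (Measure.measurable_rnDeriv μ ν), hone]
        simp

namespace WiretapCode

variable (C : WiretapCode n)

instance sFinite_output (σ : ℝ) (m : Fin C.numMsg) : SFinite (C.output σ m) := by
  unfold output; infer_instance

lemma isProbabilityMeasure_output {σ : ℝ} (hσ : 0 < σ) (m : Fin C.numMsg) :
    IsProbabilityMeasure (C.output σ m) := by
  have := isProbabilityMeasure_gaussianNoise (n := n) hσ
  unfold output
  infer_instance

lemma sum_pmf (p : PMF (Fin C.numMsg)) : ∑ m, p m = 1 :=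
  (tsum_fintype p).symm.trans p.tsum_coe

lemma joint_apply (σ : ℝ) (p : PMF (Fin C.numMsg)) {S : Set (Fin C.numMsg × E n)}
    (hS : MeasurableSet S) : C.joint σ p S = ∑ m, p m * C.output σ m (Prod.mk m ⁻¹' S) := by
  simp [joint, Measure.dirac_prod, Measure.map_apply measurable_prodMk_left hS]

lemma isProbabilityMeasure_joint {σ : ℝ} (hσ : 0 < σ) (p : PMF (Fin C.numMsg)) :
    IsProbabilityMeasure (C.joint σ p) := by
  have (m : Fin C.numMsg) := C.isProbabilityMeasure_output hσ m
  exact ⟨by simp [C.joint_apply σ p .univ, C.sum_pmf p]⟩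

lemma joint_snd_apply (σ : ℝ) (p : PMF (Fin C.numMsg)) {S : Set (E n)} (hS : MeasurableSet S) :
    (C.joint σ p).snd S = ∑ m, p m * C.output σ m S := by
  rw [Measure.snd_apply hS, C.joint_apply σ p (measurable_snd hS)]
  rfl

lemma joint_fst_singleton {σ : ℝ} (hσ : 0 < σ) (p : PMF (Fin C.numMsg)) (m : Fin C.numMsg) :
    (C.joint σ p).fst {m} = p m := by
  have (m : Fin C.numMsg) := C.isProbabilityMeasure_output hσ m
  rw [Measure.fst_apply (measurableSet_singleton m),
    C.joint_apply σ p (measurable_fst (measurableSet_singleton m)),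
    Finset.sum_eq_single m]
  · have : Prod.mk m ⁻¹' (Prod.fst ⁻¹' {m}) = (Set.univ : Set (E n)) := by ext; simp
    rw [this, measure_univ, mul_one]
  · intro m' _ hm'
    have : Prod.mk m' ⁻¹' (Prod.fst ⁻¹' {m}) = (∅ : Set (E n)) := by ext; simp [hm']
    rw [this, measure_empty, mul_zero]
  · simp

/-- If the output laws of all messages are comparable, little information leaks. -/
lemma leakage_le {σ c : ℝ} (hσ : 0 < σ) (hc : 1 ≤ c)
    (h : ∀ m m', C.output σ m ≤ ENNReal.ofReal c • C.output σ m') (p : PMF (Fin C.numMsg)) :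
    C.leakage σ p ≤ ENNReal.ofReal (c - 1) := by
  have := C.isProbabilityMeasure_joint hσ p
  refine klDiv_le_of_le_smul hc (Measure.le_iff.2 fun S hS => ?_)
  rw [Measure.smul_apply, Measure.prod_apply hS, lintegral_fintype, C.joint_apply σ p hS,
    smul_eq_mul, Finset.mul_sum]
  refine Finset.sum_le_sum fun m _ => ?_
  have hS' : MeasurableSet (Prod.mk m ⁻¹' S) := measurable_prodMk_left hS
  rw [C.joint_fst_singleton hσ, C.joint_snd_apply σ p hS', mul_comm (∑ m, _), mul_left_comm]
  gcongr
  calc C.output σ m (Prod.mk m ⁻¹' S) =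
        ∑ m', p m' * C.output σ m (Prod.mk m ⁻¹' S) := by
        rw [← Finset.sum_mul, C.sum_pmf, one_mul]
    _ ≤ ∑ m', p m' * (ENNReal.ofReal c * C.output σ m' (Prod.mk m ⁻¹' S)) := by
        gcongr with m'
        exact h m m' _
    _ = _ := by
        rw [Finset.mul_sum]
        exact Finset.sum_congr rfl fun m' _ => mul_left_comm _ _ _

lemma errorProb_le {σ : ℝ} {b : ℝ≥0∞} (h : ∀ m, C.output σ m {y | C.dec y ≠ m} ≤ b)
    (p : PMF (Fin C.numMsg)) : C.errorProb σ p ≤ b :=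
  calc C.errorProb σ p ≤ ∑ m, p m * b := by
        unfold errorProb
        gcongr with m
        exact h m
    _ = b := by rw [← Finset.sum_mul, C.sum_pmf, one_mul]

end WiretapCode

/-! ### Reliability of MMSE-renormalized lattice decoding -/

/-- With MMSE renormalization, the effective noise is almost Gaussian. -/
lemma discreteGaussian_conv_effective_noise_le [DiscreteTopology L] {K ε s t r : ℝ} (hK : 0 < K)
    (hε : ε < 1) (hs : 0 < s) (ht : 0 < t) (hr : 0 < r) (h : r ^ 2 = s ^ 2 + t ^ 2)
    (hfs : IsFlat L K s ε) (hfw : IsFlat L K (s ^ 2 / r) ε) {c : E n} {p : PMF (E n)}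
    (hp : ∀ x, p x = ENNReal.ofReal (discreteGaussian L c s x)) {S B : Set (E n)}
    (hS : MeasurableSet S) (hB : MeasurableSet B)
    (hBS : ∀ y ∈ B, ∀ l ∈ L, (s ^ 2 / r ^ 2) • y - (l - c) ∈ S) :
    (p.toMeasure ∗ gaussianNoise n t) B ≤
      ENNReal.ofReal ((1 + ε) / (1 - ε)) * gaussianNoise n (s * t / r) S := by
  have := countable_of_discreteTopology L
  have hw : 0 < s ^ 2 / r := by positivity
  have hu : 0 < s * t / r := by positivity
  have hα : 0 < s ^ 2 / r ^ 2 := by positivity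
  rw [discreteGaussian_conv_apply hs hp t hB]
  -- Substitution `e = αy - x` with `α = s²/r²`: its Jacobian turns `f_r(y)` into `f_{αr}(αy) =
  -- f_{s²/r}(e + x)`, while the other factor of the completed square is `f_{st/r}(e)`.
  have key (x : E n) (hx : ∀ y ∈ B, (s ^ 2 / r ^ 2) • y - x ∈ S) :
      ∫⁻ y in B, ENNReal.ofReal (gaussianDensity s 0 x * gaussianDensity t 0 (y - x)) ≤
        ∫⁻ e in S, ENNReal.ofReal (gaussianDensity (s * t / r) 0 e) *
          ENNReal.ofReal (gaussianDensity (s ^ 2 / r) 0 (e + x)) := by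
    have hm : Measurable (S.indicator fun e => ENNReal.ofReal (gaussianDensity (s * t / r) 0 e) *
        ENNReal.ofReal (gaussianDensity (s ^ 2 / r) 0 (e + x))) :=
      Measurable.indicator (by fun_prop) hS
    have hsub := lintegral_comp_smul_sub hα x hm
    rw [← lintegral_indicator hB, ← lintegral_indicator hS]
    have hα' : 0 < (s ^ 2 / r ^ 2) ^ n := by positivity
    rw [ENNReal.ofReal_inv_of_pos hα',
      mul_comm (ENNReal.ofReal ((s ^ 2 / r ^ 2) ^ n))⁻¹, ← div_eq_mul_inv,
      ENNReal.eq_div_iff (by simpa using hα') ENNReal.ofReal_ne_top,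
      ← lintegral_const_mul' _ _ ENNReal.ofReal_ne_top] at hsub
    rw [← hsub]
    refine lintegral_mono fun y => ?_
    by_cases hy : y ∈ B
    · rw [Set.indicator_of_mem hy, Set.indicator_of_mem (hx y hy), sub_add_cancel,
        gaussianDensity_mul hs ht hr h,
        show s ^ 2 / r = s ^ 2 / r ^ 2 * r by field_simp, gaussianDensity_zero_smul hα.ne',
        ← gaussianDensity_zero_neg _ (x - _), neg_sub,
        ← ENNReal.ofReal_mul (gaussianDensity_pos hu _ _).le, ← ENNReal.ofReal_mul hα'.le]
      apply ENNReal.ofReal_le_ofReal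
      rw [mul_left_comm, mul_inv_cancel_left₀ hα'.ne', mul_comm]
    · rw [Set.indicator_of_notMem hy]
      exact zero_le
  calc _ ≤ (ENNReal.ofReal (periodicGaussian L s c))⁻¹ *
        ∑' l : L, ∫⁻ e in S, ENNReal.ofReal (gaussianDensity (s * t / r) 0 e) *
          ENNReal.ofReal (gaussianDensity (s ^ 2 / r) 0 (e + ((l : E n) - c))) := by
        refine mul_le_mul' le_rfl (ENNReal.tsum_le_tsum fun l => ?_)
        exact key _ fun y hy => hBS y hy l l.2
    -- For fixed `e`, summing over the coset leaves a Gaussian sum of width `s²/r`, which by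
    -- flatness barely depends on `e`.
    _ = ∫⁻ e in S, ENNReal.ofReal (gaussianDensity (s * t / r) 0 e) *
          ((ENNReal.ofReal (periodicGaussian L s c))⁻¹ *
            ENNReal.ofReal (periodicGaussian L (s ^ 2 / r) (c - e))) := by
        rw [← lintegral_tsum fun l => by fun_prop,
          ← lintegral_const_mul _ (Measurable.tsum fun l => by fun_prop)]
        refine lintegral_congr fun e => ?_
        rw [← tsum_ofReal_gaussianDensity_sub L hw, ENNReal.tsum_mul_left, mul_left_comm]
        congr 4 with l
        congr 2
        abel
    _ ≤ _ := by
        rw [gaussianNoise_apply _ _ hS, ← lintegral_const_mul' _ _ ENNReal.ofReal_ne_top]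
        refine lintegral_mono fun e => ?_
        rw [mul_comm (ENNReal.ofReal ((1 + ε) / (1 - ε)))]
        gcongr
        exact hfs.inv_mul_ofReal_le hK hs hε hfw _ _

lemma isClosed_voronoiCell (L : Submodule ℤ (E n)) : IsClosed (voronoiCell L) := by
  simp only [voronoiCell, Set.ofPred_forall]
  exact isClosed_iInter fun l => isClosed_iInter fun _ =>
    isClosed_le continuous_norm (by fun_prop)

/-- The hypothesis says `2⟪x, l⟫ ≤ ‖l‖²`, and multiplying by `b < 1` makes it strict. Strictness
excludes ties, so the tie-breaking rule of the decoder is immaterial. -/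
lemma norm_smul_lt_norm_smul_sub {b : ℝ} (hb : 0 ≤ b) (hb1 : b < 1) {x l : E n} (hl : l ≠ 0)
    (h : ‖x‖ ≤ ‖x - l‖) : ‖b • x‖ < ‖b • x - l‖ := by
  have h2 : ‖x‖ ^ 2 ≤ ‖x - l‖ ^ 2 := by gcongr
  have hl' : 0 < ‖l‖ ^ 2 := by positivity
  refine lt_of_pow_lt_pow_left₀ 2 (norm_nonneg _) ?_
  rw [norm_sub_sq_real] at h2 ⊢
  rw [real_inner_smul_left]
  nlinarith

/-- A slightly shrunk Voronoi cell of `a • L` consists of points whose only nearest lattice point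
is `0`. -/
lemma norm_lt_norm_sub_of_mem_voronoiCell {a t : ℝ} (ht : 0 < t) (hta : t < a) {x l : E n}
    (hx : t⁻¹ • x ∈ voronoiCell L) (hl : l ∈ a • L) (hl0 : l ≠ 0) : ‖x‖ < ‖x - l‖ := by
  have ha : 0 < a := ht.trans hta
  have hl' := (mem_smul_iff ha.ne' L l).1 hl
  have hb : t / a < 1 := (div_lt_one ha).2 hta
  have h := norm_smul_lt_norm_smul_sub (b := t / a) (by positivity) hb
    (smul_ne_zero (inv_ne_zero ha.ne') hl0) (hx _ hl')
  rw [smul_smul, div_mul_eq_mul_div, mul_inv_cancel₀ ht.ne', one_div, ← smul_sub, norm_smul,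
    norm_smul] at h
  exact lt_of_mul_lt_mul_left h (norm_nonneg _)

/-- The error probability of a lattice Gaussian code. -/
lemma IsLatticeGaussianCode.output_error_le {Lb Le : Submodule ℤ (E n)} [DiscreteTopology Le]
    (hle : Le ≤ Lb) {K ε s t r : ℝ} (hK : 0 < K) (hε : ε < 1) (hs : 0 < s) (ht : 0 < t)
    (hr : 0 < r) (h : r ^ 2 = s ^ 2 + t ^ 2) (hfs : IsFlat Le K s ε)
    (hfw : IsFlat Le K (s ^ 2 / r) ε) {C : WiretapCode n}
    (hC : IsLatticeGaussianCode Lb Le s t C) {D : Set (E n)} (hD : MeasurableSet D)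
    (hDL : ∀ x ∈ D, ∀ l ∈ Lb, l ≠ 0 → ‖x‖ < ‖x - l‖) (m : Fin C.numMsg) :
    C.output t m {y | C.dec y ≠ m} ≤
      ENNReal.ofReal ((1 + ε) / (1 - ε)) * gaussianNoise n (s * t / r) Dᶜ := by
  have := countable_of_discreteTopology Le
  obtain ⟨rep, Q, hrep, huniq, henc, hQ, hdec⟩ := hC
  -- If `αy - x ∈ D` for a single point `x` of the coset of `m`, then `x` is the unique nearest
  -- point of `Λb` and `y` decodes to `m`; so every error lies in `B`. Unlike the error event, whose
  -- ties are broken arbitrarily, `B` is visibly measurable.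
  set B : Set (E n) := ⋂ l : Le, {y | (s ^ 2 / r ^ 2) • y - ((l : E n) - -rep m) ∈ Dᶜ}
  have hB : MeasurableSet B :=
    MeasurableSet.iInter fun l => measurableSet_preimage (by fun_prop) hD.compl
  have hsub : {y | C.dec y ≠ m} ⊆ B := by
    intro y hy
    simp only [B, Set.mem_iInter]
    intro l hlD
    apply hy
    have hx : (l : E n) - -rep m ∈ Lb := Lb.sub_mem (hle l.2) (Lb.neg_mem (hrep m))
    obtain ⟨hQL, hQmin⟩ := hQ ((s ^ 2 / r ^ 2) • y)
    have hQx : Q ((s ^ 2 / r ^ 2) • y) = (l : E n) - -rep m := by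
      by_contra hne
      have h1 := hDL _ hlD _ (Lb.sub_mem hQL hx) (sub_ne_zero.2 hne)
      rw [sub_sub_sub_cancel_right] at h1
      exact absurd (hQmin _ hx) (not_le.2 h1)
    have hd := hdec y
    rw [← h, hQx] at hd
    refine (huniq _ hx).unique hd ?_
    simp
  refine (measure_mono hsub).trans ?_
  exact discreteGaussian_conv_effective_noise_le hK hε hs ht hr h hfs hfw (henc m) hD.compl hB
    fun y hy l hl => Set.mem_iInter.1 hy ⟨l, hl⟩

/-! ### Transmission power -/

/-- The second moment of the discrete Gaussian over a flat lattice. -/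
lemma tsum_discreteGaussian_mul_norm_sq_le [DiscreteTopology L] {K ε s η : ℝ} (hK : 0 < K)
    (hε : ε ≤ 1 / 3) (hs : 0 < s) (hη : 0 < η) (hfs : IsFlat L K s ε) (c : E n) :
    ∑' x, ENNReal.ofReal (discreteGaussian L c s x) * ENNReal.ofReal (‖x‖ ^ 2) ≤
      ENNReal.ofReal ((n * η / 2 + 1) * (2 * s ^ 2 * (1 + η) / η)) := by
  set q := √(1 + η)
  have hq2 : q ^ 2 = 1 + η := Real.sq_sqrt (by positivity)
  have hq : 1 < q := by
    rw [Real.lt_sqrt] <;> linarith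
  have hq0 : 0 < q := by linarith
  have hfr : IsFlat L K (s * q) ε := hfs.mono hK hs (by nlinarith)
  -- Chosen so that `1/(2s²) - δ = 1/(2s²q²)`: tilting `f_s` by `exp (δ‖x‖²)` gives `q ^ n` times a
  -- Gaussian of width `sq`.
  set δ := η / (2 * s ^ 2 * (1 + η))
  have hδ : 0 < δ := by positivity
  set b : ℝ := n * η / 2 + 1
  have hb : 1 ≤ b := by simp only [b, le_add_iff_nonneg_left]; positivity
  have hexp : ∑' x, ENNReal.ofReal (discreteGaussian L c s x) *
      ENNReal.ofReal (Real.exp (δ * ‖x‖ ^ 2)) ≤ ENNReal.ofReal (Real.exp b) := by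
    have hg (x : E n) : ENNReal.ofReal (gaussianDensity s 0 x) *
        ENNReal.ofReal (Real.exp (δ * ‖x‖ ^ 2)) =
        ENNReal.ofReal (q ^ n) * ENNReal.ofReal (gaussianDensity (s * q) 0 x) := by
      rw [← ENNReal.ofReal_mul (gaussianDensity_pos hs _ _).le, ← ENNReal.ofReal_mul (by positivity)]
      congr 1
      have hpi := Real.pi_pos
      have he : -(‖x‖ ^ 2 / (2 * (s * q) ^ 2)) = -(‖x‖ ^ 2 / (2 * s ^ 2)) + δ * ‖x‖ ^ 2 := by
        simp only [δ]
        rw [mul_pow, hq2]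
        field_simp
        ring
      simp only [gaussianDensity, sub_zero]
      rw [he, Real.exp_add, ← mul_assoc (√(2 * Real.pi)), mul_pow _ q]
      field_simp
    rw [tsum_discreteGaussian_mul L c hs]
    simp_rw [hg]
    rw [ENNReal.tsum_mul_left, tsum_ofReal_gaussianDensity_sub L (by positivity), mul_left_comm]
    calc _ ≤ ENNReal.ofReal (q ^ n) * ENNReal.ofReal ((1 + ε) / (1 - ε)) := by
          gcongr
          exact hfs.inv_mul_ofReal_le hK hs (by linarith) hfr _ _
      _ = ENNReal.ofReal (q ^ n * ((1 + ε) / (1 - ε))) :=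
          (ENNReal.ofReal_mul (by positivity)).symm
      _ ≤ _ := by
          apply ENNReal.ofReal_le_ofReal
          rw [show b = n * (η / 2) + 1 by simp only [b]; ring, Real.exp_add, Real.exp_nat_mul]
          have h1 : q ≤ Real.exp (η / 2) := by
            have := Real.add_one_le_exp (η / 2)
            nlinarith
          -- For `ε ≤ 1/3` the quotient is at most `2`, which accounts for the `+ 1` in `b`.
          have h2 : (1 + ε) / (1 - ε) ≤ Real.exp 1 := by
            have := Real.add_one_le_exp 1
            rw [div_le_iff₀ (by linarith)]
            nlinarith
          have h3 : 0 ≤ (1 + ε) / (1 - ε) :=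
            div_nonneg (by linarith [(abs_nonneg _).trans (hfs 0)]) (by linarith)
          gcongr
  -- Jensen's inequality through the tangent of `exp` at `b`: `u ≤ b - 1 + exp (u - b)` with `u =
  -- δ‖x‖²`. Its mean is at most `b`.
  have hpt (x : E n) : ENNReal.ofReal (‖x‖ ^ 2) ≤ ENNReal.ofReal ((b - 1) / δ) +
      ENNReal.ofReal (Real.exp (-b) / δ) * ENNReal.ofReal (Real.exp (δ * ‖x‖ ^ 2)) := by
    rw [← ENNReal.ofReal_mul (by positivity),
      ← ENNReal.ofReal_add (div_nonneg (by linarith) hδ.le) (by positivity)]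
    apply ENNReal.ofReal_le_ofReal
    rw [div_mul_eq_mul_div, ← add_div, le_div_iff₀ hδ, ← Real.exp_add]
    linarith [Real.add_one_le_exp (-b + δ * ‖x‖ ^ 2)]
  calc _ ≤ ∑' x, (ENNReal.ofReal (discreteGaussian L c s x) * ENNReal.ofReal ((b - 1) / δ) +
        ENNReal.ofReal (Real.exp (-b) / δ) * (ENNReal.ofReal (discreteGaussian L c s x) *
          ENNReal.ofReal (Real.exp (δ * ‖x‖ ^ 2)))) := by
        gcongr with x
        rw [mul_left_comm, ← mul_add]
        gcongr
        exact hpt x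
    _ ≤ ENNReal.ofReal ((b - 1) / δ) +
        ENNReal.ofReal (Real.exp (-b) / δ) * ENNReal.ofReal (Real.exp b) := by
        rw [ENNReal.tsum_add, ENNReal.tsum_mul_right, ENNReal.tsum_mul_left,
          tsum_discreteGaussian L c hs, one_mul]
        gcongr
    _ = ENNReal.ofReal (b / δ) := by
        rw [← ENNReal.ofReal_mul (by positivity), div_mul_eq_mul_div, ← Real.exp_add,
          neg_add_cancel, Real.exp_zero,
          ← ENNReal.ofReal_add (div_nonneg (by linarith) hδ.le) (by positivity), ← add_div,
          sub_add_cancel]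
    _ = _ := by
        congr 1
        simp only [δ]
        rw [div_div_eq_mul_div, mul_div_assoc]

/-- The ratio by which the power of a lattice Gaussian code may exceed the variance. -/
def powerExcess (n : ℕ) : ℝ := (1 + 1 / √n) * (1 + 2 / √n)

lemma powerExcess_pos (n : ℕ) : 0 < powerExcess n := by
  unfold powerExcess
  positivity

lemma tendsto_powerExcess : Tendsto powerExcess atTop (𝓝 1) := by
  have h : Tendsto (fun n : ℕ => √(n : ℝ)) atTop atTop :=
    Real.tendsto_sqrt_atTop.comp tendsto_natCast_atTop_atTop
  have h1 := (h.const_div_atTop 1).const_add 1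
  have h2 := (h.const_div_atTop 2).const_add 1
  have h3 := h1.mul h2
  simp only [add_zero, mul_one] at h3
  exact h3

/-- Dividing the second moment bound by `n` gives `s² (1 + η)(1 + 2/(nη))`; `η = 1/√n` sends both
corrections to zero. -/
lemma IsLatticeGaussianCode.power_le {Lb Le : Submodule ℤ (E n)} [DiscreteTopology Le]
    (hn : 0 < n) {K ε s t : ℝ} (hK : 0 < K) (hε : ε ≤ 1 / 3) (hs : 0 < s)
    (hfs : IsFlat Le K s ε) {C : WiretapCode n} (hC : IsLatticeGaussianCode Lb Le s t C)
    (m : Fin C.numMsg) : C.power m ≤ ENNReal.ofReal (s ^ 2 * powerExcess n) := by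
  obtain ⟨rep, Q, hrep, huniq, henc, hQ, hdec⟩ := hC
  have hn' : (0 : ℝ) < n := by exact_mod_cast hn
  have hsq : 0 < √(n : ℝ) := Real.sqrt_pos.2 hn'
  unfold WiretapCode.power
  simp_rw [henc]
  refine (ENNReal.div_le_div_right
    (tsum_discreteGaussian_mul_norm_sq_le hK hε hs (one_div_pos.2 hsq) hfs _) _).trans ?_
  rw [← ENNReal.ofReal_natCast, ← ENNReal.ofReal_div_of_pos hn']
  apply le_of_eq
  congr 1
  unfold powerExcess
  have : (n : ℝ) = √n ^ 2 := (Real.sq_sqrt hn'.le).symm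
  generalize √(n : ℝ) = w at *
  rw [this]
  field_simp

/-! ### Lattice Gaussian codes -/

lemma natCard_quotient_eq_relIndex (Lb Le : Submodule ℤ (E n)) :
    Nat.card (Lb ⧸ Le.submoduleOf Lb) = Le.toAddSubgroup.relIndex Lb.toAddSubgroup :=
  rfl

lemma covolume_eq_natCard_mul {Lb Le : Submodule ℤ (E n)} [DiscreteTopology Lb] [IsZLattice ℝ Lb]
    [DiscreteTopology Le] [IsZLattice ℝ Le] (h : Le ≤ Lb) :
    ZLattice.covolume Le = Nat.card (Lb ⧸ Le.submoduleOf Lb) * ZLattice.covolume Lb := by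
  rw [natCard_quotient_eq_relIndex, ← ZLattice.covolume_div_covolume_eq_relIndex' Le Lb h,
    div_mul_cancel₀ _ (ZLattice.covolume_ne_zero Lb volume)]

/-- An infinite quotient would have `Nat.card` equal to `0` and force `V(Λe) = 0`, so positivity
encodes finite index. -/
lemma natCard_quotient_pos {Lb Le : Submodule ℤ (E n)} [DiscreteTopology Lb] [IsZLattice ℝ Lb]
    [DiscreteTopology Le] [IsZLattice ℝ Le] (h : Le ≤ Lb) :
    0 < Nat.card (Lb ⧸ Le.submoduleOf Lb) := by
  refine Nat.pos_of_ne_zero fun h0 => ZLattice.covolume_ne_zero Le volume ?_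
  rw [covolume_eq_natCard_mul h, h0, Nat.cast_zero, zero_mul]

lemma IsLatticeGaussianCode.numMsg_eq {Lb Le : Submodule ℤ (E n)} {a s t : ℝ} (ha : a ≠ 0)
    {C : WiretapCode n} (hC : IsLatticeGaussianCode (a • Lb) (a • Le) s t C) :
    C.numMsg = Nat.card (Lb ⧸ Le.submoduleOf Lb) := by
  obtain ⟨rep, Q, hrep, huniq, henc, hQ, hdec⟩ := hC
  let f (m : Fin C.numMsg) : Lb ⧸ Le.submoduleOf Lb :=
    Submodule.Quotient.mk ⟨a⁻¹ • rep m, (mem_smul_iff ha Lb _).1 (hrep m)⟩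
  have hf : Function.Bijective f := by
    constructor
    · intro m m' h
      have h' := (Submodule.Quotient.eq _).1 h
      refine (huniq _ (hrep m)).unique (by simp) ?_
      rw [mem_smul_iff ha, smul_sub]
      exact h'
    · intro q
      obtain ⟨l, rfl⟩ := Submodule.Quotient.mk_surjective _ q
      obtain ⟨m, hm, -⟩ := huniq (a • (l : E n)) (Submodule.smul_mem_pointwise_smul _ _ _ l.2)
      refine ⟨m, ((Submodule.Quotient.eq _).2 ?_).symm⟩
      rw [mem_smul_iff ha, smul_sub, inv_smul_smul₀ ha] at hm
      exact hm
  rw [← Nat.card_eq_of_bijective f hf, Nat.card_fin]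

/-- A discrete subgroup is closed, so in a finite-dimensional space the distance to it is attained.
-/
lemma exists_isQuantizer (L : Submodule ℤ (E n)) [DiscreteTopology L] :
    ∃ Q : E n → E n, IsQuantizer L Q := by
  have hcl : IsClosed (L : Set (E n)) := by
    have : DiscreteTopology L.toAddSubgroup := inferInstanceAs (DiscreteTopology L)
    exact AddSubgroup.isClosed_of_discrete (H := L.toAddSubgroup)
  choose Q hQ hd using fun x : E n => hcl.exists_infDist_eq_dist ⟨0, L.zero_mem⟩ x
  refine ⟨Q, fun x => ⟨hQ x, fun l hl => ?_⟩⟩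
  rw [← dist_eq_norm, ← dist_eq_norm, ← hd]
  exact Metric.infDist_le_dist_of_mem hl

lemma exists_isLatticeGaussianCode {Lb Le : Submodule ℤ (E n)} [DiscreteTopology Lb]
    [IsZLattice ℝ Lb] [DiscreteTopology Le] [IsZLattice ℝ Le] (h : Le ≤ Lb) {a s : ℝ} (ha : a ≠ 0)
    (hs : 0 < s) (t : ℝ) : ∃ C, IsLatticeGaussianCode (a • Lb) (a • Le) s t C := by
  have : Finite (Lb ⧸ Le.submoduleOf Lb) := Nat.finite_of_card_ne_zero (natCard_quotient_pos h).ne'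
  let e := (Finite.equivFin (Lb ⧸ Le.submoduleOf Lb)).symm
  let rep (m : Fin (Nat.card (Lb ⧸ Le.submoduleOf Lb))) : E n := a • ((e m).out : E n)
  have hrep (m) : rep m ∈ a • Lb := Submodule.smul_mem_pointwise_smul _ _ _ (e m).out.2
  have hiff {l : E n} (hl : l ∈ a • Lb) (m) :
      l - rep m ∈ a • Le ↔ m = e.symm (Submodule.Quotient.mk ⟨_, (mem_smul_iff ha Lb l).1 hl⟩) := by
    have hout : (Submodule.Quotient.mk (e m).out : Lb ⧸ Le.submoduleOf Lb) = e m :=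
      Quotient.out_eq (e m)
    rw [e.eq_symm_apply, eq_comm, ← hout, Submodule.Quotient.eq, mem_smul_iff ha, smul_sub,
      inv_smul_smul₀ ha]
    rfl
  have huniq (l) (hl : l ∈ a • Lb) : ∃! m, l - rep m ∈ a • Le :=
    ⟨_, (hiff hl _).2 rfl, fun m hm => (hiff hl m).1 hm⟩
  obtain ⟨Q, hQ⟩ := exists_isQuantizer (a • Lb)
  choose dec hdec _ using fun y : E n => huniq _ (hQ ((s ^ 2 / (s ^ 2 + t ^ 2)) • y)).1
  let C : WiretapCode n :=
    { numMsg := Nat.card (Lb ⧸ Le.submoduleOf Lb)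
      enc := fun m => ⟨fun x => ENNReal.ofReal (discreteGaussian (a • Le) (-rep m) s x),
        ENNReal.summable.hasSum_iff.2 (tsum_discreteGaussian (a • Le) (-rep m) hs)⟩
      dec := dec }
  exact ⟨C, rep, Q, hrep, huniq, fun _ _ => rfl, hQ, hdec⟩

/-! ### Good sequences of scaled lattices -/

/-- The noise level at which `Λ` has volume-to-noise ratio `γ`. -/
def noiseLevel (Λ : Submodule ℤ (E n)) (γ : ℝ) : ℝ :=
  √(ZLattice.covolume Λ ^ (2 / (n : ℝ)) / γ)

section noiseLevel

variable {Λ : Submodule ℤ (E n)} [DiscreteTopology Λ] [IsZLattice ℝ Λ] {γ : ℝ}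

lemma covolume_rpow_pos (Λ : Submodule ℤ (E n)) [DiscreteTopology Λ] [IsZLattice ℝ Λ] (x : ℝ) :
    0 < ZLattice.covolume Λ ^ x :=
  Real.rpow_pos_of_pos (ZLattice.covolume_pos Λ) _

lemma noiseLevel_pos (hγ : 0 < γ) : 0 < noiseLevel Λ γ :=
  Real.sqrt_pos.2 (div_pos (covolume_rpow_pos Λ _) hγ)

lemma noiseLevel_sq (hγ : 0 < γ) :
    noiseLevel Λ γ ^ 2 = ZLattice.covolume Λ ^ (2 / (n : ℝ)) / γ :=
  Real.sq_sqrt (div_pos (covolume_rpow_pos Λ _) hγ).le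

lemma vnr_noiseLevel (hγ : 0 < γ) : vnr Λ (noiseLevel Λ γ) = γ := by
  have := covolume_rpow_pos Λ (2 / (n : ℝ))
  rw [vnr, noiseLevel_sq hγ]
  field_simp

end noiseLevel

lemma tendsto_exp_neg_mul_natCast {c : ℝ} (hc : 0 < c) :
    Tendsto (fun n : ℕ => Real.exp (-(c * n))) atTop (𝓝 0) :=
  Real.tendsto_exp_neg_atTop_nhds_zero.comp
    (tendsto_natCast_atTop_atTop.const_mul_atTop hc)

lemma isFlat_of_flatnessFactor_le {Λ : Submodule ℤ (E n)} {σ ε : ℝ} (hε : 0 ≤ ε)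
    (h : flatnessFactor Λ σ ≤ ENNReal.ofReal ε) : IsFlat Λ (ZLattice.covolume Λ) σ ε :=
  fun x => (ENNReal.ofReal_le_ofReal_iff hε).1 (iSup_le_iff.1 h x)

/-- Scaled secrecy-good lattices are flat at all noise levels above the threshold. -/
lemma SecrecyGood.exists_isFlat {Λ : ∀ n : ℕ, Submodule ℤ (E n)} [∀ n, DiscreteTopology (Λ n)]
    [∀ n, IsZLattice ℝ (Λ n)] (hΛ : SecrecyGood Λ) {a : ℕ → ℝ} (ha : ∀ n, 0 < a n) {T H : ℝ}
    (hT : Tendsto (fun n : ℕ => a n ^ 2 * ZLattice.covolume (Λ n) ^ (2 / (n : ℝ))) atTop (𝓝 T))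
    (hT0 : 0 < T) (hH : 0 < H) (hTH : T < 2 * Real.pi * H) :
    ∃ ε : ℕ → ℝ, Tendsto ε atTop (𝓝 0) ∧ ∀ᶠ n in atTop, ∀ τ : ℝ, 0 < τ → H ≤ τ ^ 2 →
      IsFlat (a n • Λ n) (a n ^ n * ZLattice.covolume (Λ n)) τ (ε n) := by
  -- Secrecy-goodness is used at this one ratio `γ` in `(T/H, 2π)`. The scaled noise level then has
  -- square tending to `T/γ < H`, so every `τ` with `τ² ≥ H` is eventually wider and inherits
  -- flatness.
  obtain ⟨γ, hγ1, hγ2⟩ := exists_between ((div_lt_iff₀ hH).2 hTH)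
  have hγ0 : 0 < γ := (div_pos hT0 hH).trans hγ1
  obtain ⟨c, hc, hdecay⟩ := hΛ γ hγ0 hγ2 (fun n => noiseLevel (Λ n) γ)
    (fun n => noiseLevel_pos hγ0) fun n => vnr_noiseLevel hγ0
  refine ⟨fun n => Real.exp (-(c * n)), tendsto_exp_neg_mul_natCast hc, ?_⟩
  have hlim := hT.div_const γ
  have hev := hlim.eventually_lt_const ((div_lt_comm₀ hγ0 hH).2 hγ1)
  filter_upwards [hdecay, hev] with n hn hn' τ hτ hHτ
  have hν := noiseLevel_pos (Λ := Λ n) hγ0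
  refine ((isFlat_of_flatnessFactor_le (Real.exp_pos _).le hn).smul (ha n)).mono
    (mul_pos (pow_pos (ha n) n) (ZLattice.covolume_pos (Λ n))) (mul_pos (ha n) hν) ?_
  refine lt_of_pow_lt_pow_left₀ 2 hτ.le (lt_of_lt_of_le ?_ hHτ)
  rwa [mul_pow, noiseLevel_sq hγ0, ← mul_div_assoc]

/-- Scaled AWGN-good lattices: Gaussian noise below the threshold is decoded correctly. -/
lemma AWGNGood.exists_decoding_region {Λ : ∀ n : ℕ, Submodule ℤ (E n)}
    [∀ n, DiscreteTopology (Λ n)] [∀ n, IsZLattice ℝ (Λ n)] (hΛ : AWGNGood Λ) {a : ℕ → ℝ}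
    (ha : ∀ n, 0 < a n) {T B : ℝ}
    (hT : ∀ n : ℕ, a n ^ 2 * ZLattice.covolume (Λ n) ^ (2 / (n : ℝ)) = T)
    (hB : 0 < B) (hTB : 2 * Real.pi * Real.exp 1 * B < T) :
    ∃ b : ℕ → ℝ≥0∞, Tendsto b atTop (𝓝 0) ∧ ∀ n, ∀ τ : ℝ, 0 < τ → τ ^ 2 < B →
      ∃ D : Set (E n), MeasurableSet D ∧ (∀ x ∈ D, ∀ l ∈ a n • Λ n, l ≠ 0 → ‖x‖ < ‖x - l‖) ∧
        gaussianNoise n τ Dᶜ ≤ b n := by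
  have hpi := Real.pi_pos
  have hT0 : 0 < T := lt_trans (by positivity) hTB
  have hγ0 : 0 < T / B := by positivity
  obtain ⟨c, hc, hdecay⟩ := hΛ (T / B) ((lt_div_iff₀ hB).2 hTB)
    (fun n => noiseLevel (Λ n) (T / B)) (fun n => noiseLevel_pos hγ0) fun n => vnr_noiseLevel hγ0
  refine ⟨fun n => gaussianNoise n (noiseLevel (Λ n) (T / B)) (voronoiCell (Λ n))ᶜ, ?_, ?_⟩
  · refine tendsto_of_tendsto_of_tendsto_of_le_of_le' tendsto_const_nhds ?_
      (.of_forall fun _ => zero_le) hdecay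
    simpa using ENNReal.tendsto_ofReal (tendsto_exp_neg_mul_natCast hc)
  · intro n τ hτ hτB
    have hν := noiseLevel_pos (Λ := Λ n) hγ0
    set ν := noiseLevel (Λ n) (T / B)
    -- At ratio `T/B` the scaled noise level satisfies `(a n * ν)² = B > τ²`, so `τ/ν < a n`. The
    -- region `D` is the Voronoi cell of `Λ n` scaled by `τ/ν`: strictly smaller than that of `a n •
    -- Λ n`, yet noise `τ` leaves it exactly as often as noise `ν` leaves the original cell.
    have ht : 0 < τ / ν := by positivity
    have hlt : τ / ν < a n := by
      rw [div_lt_iff₀ hν]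
      refine lt_of_pow_lt_pow_left₀ 2 (mul_pos (ha n) hν).le (hτB.trans_eq ?_)
      rw [mul_pow, noiseLevel_sq hγ0, ← mul_div_assoc, hT]
      field_simp
    have hm : MeasurableSet {x : E n | (τ / ν)⁻¹ • x ∈ voronoiCell (Λ n)} :=
      measurableSet_preimage (by fun_prop) (isClosed_voronoiCell _).measurableSet
    refine ⟨_, hm, fun x hx l hl hl0 => norm_lt_norm_sub_of_mem_voronoiCell ht hlt hx hl hl0, ?_⟩
    have hmul := gaussianNoise_mul_apply (σ := ν) ht hm.compl
    rw [div_mul_cancel₀ τ hν.ne'] at hmul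
    rw [hmul]
    apply le_of_eq
    congr 1
    ext x
    simp only [Set.mem_compl_iff, Set.mem_ofPred_eq, inv_smul_smul₀ ht.ne']

/-! ### Asymptotics -/

lemma tendsto_natCard_rpow {M : ℕ → ℕ} (hM : ∀ n, 0 < M n) {R : ℝ}
    (h : Tendsto (fun n : ℕ => Real.log (M n) / n) atTop (𝓝 R)) :
    Tendsto (fun n : ℕ => (M n : ℝ) ^ (2 / (n : ℝ))) atTop (𝓝 (Real.exp (2 * R))) := by
  refine ((Real.continuous_exp.tendsto _).comp (h.const_mul 2)).congr fun n => ?_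
  rw [Real.rpow_def_of_pos (by exact_mod_cast hM n)]
  simp only [Function.comp]
  congr 1
  ring

lemma tendsto_flatness_ratio {ε : ℕ → ℝ} (hε : Tendsto ε atTop (𝓝 0)) :
    Tendsto (fun n => (1 + ε n) / (1 - ε n)) atTop (𝓝 1) := by
  have := (hε.const_add 1).div (hε.const_sub 1) (by norm_num)
  rwa [add_zero, sub_zero, div_one] at this

/-- The requirements on the lattices, on the power and on the rate leave room for a choice of the
scaling. -/
lemma exists_scaling_constants {P σb σe R : ℝ} (hP : 0 < P) (hσb : 0 < σb) (hσe : 0 < σe)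
    (hR : R < 1 / 2 * Real.log (min ((1 + P / σb ^ 2) / (1 + P / σe ^ 2)) (P / σb ^ 2)) - 1 / 2) :
    ∃ T B H : ℝ, P * σb ^ 2 / (P + σb ^ 2) < B ∧ 2 * Real.pi * Real.exp 1 * B < T ∧
      Real.exp (2 * R) * T < 2 * Real.pi * H ∧ H < P ^ 2 / (P + σb ^ 2) ∧
      H < P * σe ^ 2 / (P + σe ^ 2) := by
  have hpi := Real.pi_pos
  set A := P * σb ^ 2 / (P + σb ^ 2)
  have hA : 0 < A := by positivity
  set m := min ((1 + P / σb ^ 2) / (1 + P / σe ^ 2)) (P / σb ^ 2)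
  have hm : 0 < m := lt_min (by positivity) (by positivity)
  have hexp : Real.exp (2 * R + 1) < m := by
    rw [← Real.lt_log_iff_exp_lt hm]
    linarith
  -- Relative to `A = P/(1 + SNR_b)`, the two flatness thresholds are larger by the factors `SNR_b`
  -- and `(1 + SNR_b)/(1 + SNR_e)`, the two terms of the minimum `m`.
  have h1 : m * A ≤ P ^ 2 / (P + σb ^ 2) := by
    calc m * A ≤ P / σb ^ 2 * A := by gcongr; exact min_le_right _ _
      _ = _ := by simp only [A]; field_simp
  have h2 : m * A ≤ P * σe ^ 2 / (P + σe ^ 2) := by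
    calc m * A ≤ (1 + P / σb ^ 2) / (1 + P / σe ^ 2) * A := by gcongr; exact min_le_left _ _
      _ = _ := by simp only [A]; field_simp; ring
  have e1 := Real.exp_pos 1
  have e2 := Real.exp_pos (2 * R)
  rw [Real.exp_add] at hexp
  obtain ⟨B, hB1, hB2⟩ := exists_between
    (show A < m * A / (Real.exp (2 * R) * Real.exp 1) by
      rw [lt_div_iff₀ (by positivity)]; nlinarith)
  rw [lt_div_iff₀ (by positivity)] at hB2
  obtain ⟨T, hT1, hT2⟩ := exists_between
    (show 2 * Real.pi * Real.exp 1 * B < 2 * Real.pi * (m * A) / Real.exp (2 * R) by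
      rw [lt_div_iff₀ e2]; nlinarith)
  rw [lt_div_iff₀ e2] at hT2
  obtain ⟨H, hH1, hH2⟩ := exists_between
    (show Real.exp (2 * R) * T / (2 * Real.pi) < m * A by
      rw [div_lt_iff₀ (by positivity)]; linarith)
  rw [div_lt_iff₀ (by positivity)] at hH1
  exact ⟨T, B, H, hB1, hT1, by linarith, hH2.trans_le h1, hH2.trans_le h2⟩

/-- Lattices that are flat at the noise level of the eavesdropper leak little information. -/
lemma IsLatticeGaussianCode.leakage_le {Lb Le : Submodule ℤ (E n)} [DiscreteTopology Le]
    {K ε s t t' r : ℝ} (hK : 0 < K) (hε : ε < 1) (hs : 0 < s) (ht : 0 < t) (hr : 0 < r)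
    (h : r ^ 2 = s ^ 2 + t ^ 2) (hfs : IsFlat Le K s ε) (hfu : IsFlat Le K (s * t / r) ε)
    {C : WiretapCode n} (hC : IsLatticeGaussianCode Lb Le s t' C) (p : PMF (Fin C.numMsg)) :
    C.leakage t p ≤
      ENNReal.ofReal ((1 + ε) / (1 - ε) * ((1 + ε) / (1 - ε)) - 1) := by
  obtain ⟨rep, Q, hrep, huniq, henc, hQ, hdec⟩ := hC
  have hε0 : 0 ≤ ε := (abs_nonneg _).trans (hfs 0)
  have h1 : 1 ≤ (1 + ε) / (1 - ε) := by
    rw [one_le_div (by linarith)]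
    linarith
  refine C.leakage_le ht (one_le_mul_of_one_le_of_one_le h1 h1) (fun m m' => ?_) p
  rw [ENNReal.ofReal_mul (by linarith), mul_smul]
  refine (discreteGaussian_conv_le hK hε hs ht hr h hfs hfu (henc m)).trans ?_
  refine Measure.le_iff.2 fun S _ => ?_
  rw [Measure.smul_apply, Measure.smul_apply]
  exact mul_le_mul' le_rfl
    (le_discreteGaussian_conv hK hε hs ht hr h hfs hfu (henc m') S)

lemma IsLatticeGaussianCode.rate_eq {Lb Le : Submodule ℤ (E n)} {a s t : ℝ} (ha : a ≠ 0)
    {C : WiretapCode n} (hC : IsLatticeGaussianCode (a • Lb) (a • Le) s t C) :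
    C.rate = Real.log (Nat.card (Lb ⧸ Le.submoduleOf Lb)) / n := by
  rw [WiretapCode.rate, hC.numMsg_eq ha]

/-- The conditions under which the codes of a sequence are good: flatness at the signal level, at
the noise level of the eavesdropper and at that of the effective noise, and reliable decoding of
the effective noise. -/
structure GoodAt (Lb Le : Submodule ℤ (E n)) (σb σe K ε : ℝ) (b : ℝ≥0∞) (s : ℝ) :
    Prop where
  flat : IsFlat Le K s ε
  flat_eve : IsFlat Le K (s * σe / √(s ^ 2 + σe ^ 2)) ε
  flat_effective : IsFlat Le K (s ^ 2 / √(s ^ 2 + σb ^ 2)) ε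
  decoding : ∃ D : Set (E n), MeasurableSet D ∧ (∀ x ∈ D, ∀ l ∈ Lb, l ≠ 0 → ‖x‖ < ‖x - l‖) ∧
    gaussianNoise n (s * σb / √(s ^ 2 + σb ^ 2)) Dᶜ ≤ b

/-- All requirements are strict inequalities at `s² = P`, so one scaling, fixed beforehand, serves
every sequence with `s n ^ 2 → P`. -/
lemma exists_scaling_goodAt {P σb σe R : ℝ} (hP : 0 < P) (hσb : 0 < σb) (hσe : 0 < σe)
    (hR : R < 1 / 2 * Real.log (min ((1 + P / σb ^ 2) / (1 + P / σe ^ 2)) (P / σb ^ 2)) - 1 / 2)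
    {Λb Λe : ∀ n : ℕ, Submodule ℤ (E n)}
    [∀ n, DiscreteTopology (Λb n)] [∀ n, IsZLattice ℝ (Λb n)]
    [∀ n, DiscreteTopology (Λe n)] [∀ n, IsZLattice ℝ (Λe n)] (hnested : ∀ n, Λe n ≤ Λb n)
    (hrate : Tendsto (fun n : ℕ =>
      Real.log (Nat.card (Λb n ⧸ (Λe n).submoduleOf (Λb n))) / n) atTop (𝓝 R))
    (hΛb : AWGNGood Λb) (hΛe : SecrecyGood Λe) :
    ∃ (a K ε : ℕ → ℝ) (b : ℕ → ℝ≥0∞), (∀ n, 0 < a n) ∧ (∀ n, 0 < K n) ∧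
      Tendsto ε atTop (𝓝 0) ∧ Tendsto b atTop (𝓝 0) ∧
      ∀ s : ℕ → ℝ, (∀ n, 0 < s n) → Tendsto (fun n => s n ^ 2) atTop (𝓝 P) →
        ∀ᶠ n in atTop, GoodAt (a n • Λb n) (a n • Λe n) σb σe (K n) (ε n) (b n) (s n) := by
  obtain ⟨T, B, H, hB, hTB, hTH, hH1, hH2⟩ := exists_scaling_constants hP hσb hσe hR
  have hpi := Real.pi_pos
  have hB0 : 0 < B := lt_trans (by positivity) hB
  have hT0 : 0 < T := lt_trans (by positivity) hTB
  have hRT : 0 < Real.exp (2 * R) * T := by positivity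
  have hH0 : 0 < H := pos_of_mul_pos_right (hRT.trans hTH) (by positivity)
  set a : ℕ → ℝ := fun n => √(T / ZLattice.covolume (Λb n) ^ (2 / (n : ℝ)))
  have hVb (n : ℕ) := covolume_rpow_pos (Λb n) (2 / (n : ℝ))
  have ha (n : ℕ) : 0 < a n := Real.sqrt_pos.2 (div_pos hT0 (hVb n))
  have haT (n : ℕ) : a n ^ 2 * ZLattice.covolume (Λb n) ^ (2 / (n : ℝ)) = T := by
    rw [Real.sq_sqrt (div_pos hT0 (hVb n)).le, div_mul_cancel₀ _ (hVb n).ne']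
  have haR : Tendsto (fun n : ℕ => a n ^ 2 * ZLattice.covolume (Λe n) ^ (2 / (n : ℝ))) atTop
      (𝓝 (Real.exp (2 * R) * T)) := by
    refine ((tendsto_natCard_rpow (fun n => natCard_quotient_pos (hnested n)) hrate).mul_const
      T).congr fun n => ?_
    rw [covolume_eq_natCard_mul (hnested n), Real.mul_rpow (Nat.cast_nonneg _)
      (ZLattice.covolume_pos (Λb n) volume).le, ← haT n]
    ring
  obtain ⟨ε, hε, hflat⟩ := hΛe.exists_isFlat ha haR hRT hH0 hTH
  obtain ⟨b, hb, hdec⟩ := hΛb.exists_decoding_region ha haT hB0 hTB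
  refine ⟨a, fun n => a n ^ n * ZLattice.covolume (Λe n), ε, b, ha,
    fun n => mul_pos (pow_pos (ha n) n) (ZLattice.covolume_pos (Λe n)), hε, hb,
    fun s hs hsP => ?_⟩
  have sq_div {x y z : ℝ} (hz : 0 < z) : (x * y / √z) ^ 2 = x ^ 2 * y ^ 2 / z := by
    rw [div_pow, mul_pow, Real.sq_sqrt hz.le]
  have hPb : P + σb ^ 2 ≠ 0 := by positivity
  have hPe : P + σe ^ 2 ≠ 0 := by positivity
  have l1 : Tendsto (fun n => s n ^ 2 * σe ^ 2 / (s n ^ 2 + σe ^ 2)) atTop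
      (𝓝 (P * σe ^ 2 / (P + σe ^ 2))) := (hsP.mul_const _).div (hsP.add_const _) hPe
  have l2 : Tendsto (fun n => s n ^ 2 * s n ^ 2 / (s n ^ 2 + σb ^ 2)) atTop
      (𝓝 (P ^ 2 / (P + σb ^ 2))) := by
    rw [pow_two P]
    exact (hsP.mul hsP).div (hsP.add_const _) hPb
  have l3 : Tendsto (fun n => s n ^ 2 * σb ^ 2 / (s n ^ 2 + σb ^ 2)) atTop
      (𝓝 (P * σb ^ 2 / (P + σb ^ 2))) := (hsP.mul_const _).div (hsP.add_const _) hPb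
  -- Flatness at the signal level `s` costs nothing: the eavesdropper threshold is already below
  -- `P`.
  have hHP : H < P := hH2.trans_le ((div_le_iff₀ (by positivity)).2 (by nlinarith))
  filter_upwards [hflat, hsP.eventually_const_lt hHP, l1.eventually_const_lt hH2,
    l2.eventually_const_lt hH1, l3.eventually_lt_const hB] with n hn h0 h1 h2 h3
  have hsn := hs n
  have hqb : 0 < s n ^ 2 + σb ^ 2 := by positivity
  have hqe : 0 < s n ^ 2 + σe ^ 2 := by positivity
  refine ⟨hn _ hsn h0.le, hn _ (by positivity) ?_, hn _ (by positivity) ?_,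
    hdec n _ (by positivity) ?_⟩
  · rw [sq_div hqe]
    exact h1.le
  · rw [pow_two (s n), sq_div (by rwa [← pow_two])]
    simpa only [← pow_two] using h2.le
  · rwa [sq_div hqb]

end LatticeWiretap

end

/-! ### Rate, reliability, secrecy and power of the codes -/

theorem theorem5
    (P σb σe R : ℝ) (hP : 0 < P) (hσb : 0 < σb) (hσe : 0 < σe)
    (hSNRb : Real.exp 1 < P / σb ^ 2)
    (hSNR : Real.exp 1 < (1 + P / σb ^ 2) / (1 + P / σe ^ 2))
    (hR : R < 1 / 2 * Real.log (min ((1 + P / σb ^ 2) / (1 + P / σe ^ 2)) (P / σb ^ 2)) - 1 / 2)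
    (Λb Λe : ∀ n : ℕ, Submodule ℤ (E n))
    [∀ n, DiscreteTopology (Λb n)] [∀ n, IsZLattice ℝ (Λb n)]
    [∀ n, DiscreteTopology (Λe n)] [∀ n, IsZLattice ℝ (Λe n)]
    (hnested : ∀ n, Λe n ≤ Λb n)
    (hrate : Tendsto (fun n : ℕ =>
      Real.log (Nat.card (Λb n ⧸ (Λe n).submoduleOf (Λb n))) / n) atTop (𝓝 R))
    (hΛb : AWGNGood Λb) (hΛe : SecrecyGood Λe) :
    ∃ a : ℕ → ℝ, (∀ n, 0 < a n) ∧
      -- any choice of the signal variance that tends to `P`, in particular `σs n = √P`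
      (∀ σs : ℕ → ℝ, (∀ n, 0 < σs n) → Tendsto (fun n => σs n ^ 2) atTop (𝓝 P) →
        (∃ C : ∀ n : ℕ, WiretapCode n,
          ∀ n, IsLatticeGaussianCode (a n • Λb n) (a n • Λe n) (σs n) σb (C n)) ∧
        ∀ C : ∀ n : ℕ, WiretapCode n,
          (∀ n, IsLatticeGaussianCode (a n • Λb n) (a n • Λe n) (σs n) σb (C n)) →
          AchievesStrongSecrecy σb σe R C ∧
          ∀ P' > P, ∀ᶠ n in atTop, ∀ m, (C n).power m ≤ ENNReal.ofReal P') ∧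
      -- a choice for which the power constraint holds exactly, message by message
      (∃ σs : ℕ → ℝ, (∀ n, 0 < σs n) ∧ Tendsto (fun n => σs n ^ 2) atTop (𝓝 P) ∧
        ∀ C : ∀ n : ℕ, WiretapCode n,
          (∀ n, IsLatticeGaussianCode (a n • Λb n) (a n • Λe n) (σs n) σb (C n)) →
          ∀ᶠ n in atTop, ∀ m, (C n).power m ≤ ENNReal.ofReal P) := by
  obtain ⟨a, K, ε, b, ha, hK, hε, hb, hgood⟩ :=
    exists_scaling_goodAt hP hσb hσe hR hnested hrate hΛb hΛe
  have hε1 : ∀ᶠ n in atTop, ε n < 1 / 3 := hε.eventually_lt_const (by norm_num)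
  have hsq {s t : ℝ} : √(s ^ 2 + t ^ 2) ^ 2 = s ^ 2 + t ^ 2 := Real.sq_sqrt (by positivity)
  have hpos {s t : ℝ} (hs : 0 < s) : 0 < √(s ^ 2 + t ^ 2) := Real.sqrt_pos.2 (by positivity)
  have hpower (s : ℕ → ℝ) (hs : ∀ n, 0 < s n) (hsP : Tendsto (fun n => s n ^ 2) atTop (𝓝 P))
      (C : ∀ n : ℕ, WiretapCode n)
      (hC : ∀ n, IsLatticeGaussianCode (a n • Λb n) (a n • Λe n) (s n) σb (C n)) :
      ∀ᶠ n in atTop, ∀ m, (C n).power m ≤ ENNReal.ofReal (s n ^ 2 * powerExcess n) := by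
    filter_upwards [hgood s hs hsP, hε1, eventually_gt_atTop 0] with n hn hεn hn0 m
    exact (hC n).power_le hn0 (hK n) hεn.le (hs n) hn.flat m
  refine ⟨a, ha, fun s hs hsP => ⟨?_, fun C hC => ⟨⟨?_, ?_, ?_⟩, fun P' hP' => ?_⟩⟩, ?_⟩
  · choose C hC using fun n =>
      exists_isLatticeGaussianCode (hnested n) (ha n).ne' (hs n) σb
    exact ⟨C, hC⟩
  · exact hrate.congr fun n => ((hC n).rate_eq (ha n).ne').symm
  · have hlim : Tendsto (fun n => ENNReal.ofReal ((1 + ε n) / (1 - ε n)) * b n) atTop (𝓝 0) := by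
      have := ENNReal.Tendsto.mul (ENNReal.tendsto_ofReal (tendsto_flatness_ratio hε))
        (.inr ENNReal.zero_ne_top) hb (.inr ENNReal.ofReal_ne_top)
      rwa [mul_zero] at this
    refine tendsto_of_tendsto_of_tendsto_of_le_of_le' tendsto_const_nhds hlim
      (.of_forall fun _ => zero_le) ?_
    filter_upwards [hgood s hs hsP, hε1] with n hn hεn
    obtain ⟨D, hD, hDL, hDb⟩ := hn.decoding
    refine iSup_le fun p => (C n).errorProb_le (fun m => ?_) p
    refine ((hC n).output_error_le (smul_mono_right (a n) (hnested n)) (hK n) (by linarith) (hs n)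
      hσb (hpos (hs n)) hsq hn.flat hn.flat_effective hD hDL m).trans ?_
    gcongr
  · have hlim : Tendsto (fun n => ENNReal.ofReal
        ((1 + ε n) / (1 - ε n) * ((1 + ε n) / (1 - ε n)) - 1)) atTop (𝓝 0) := by
      have h1 := tendsto_flatness_ratio hε
      have := ENNReal.tendsto_ofReal ((h1.mul h1).sub_const 1)
      rwa [mul_one, sub_self, ENNReal.ofReal_zero] at this
    refine tendsto_of_tendsto_of_tendsto_of_le_of_le' tendsto_const_nhds hlim
      (.of_forall fun _ => zero_le) ?_
    filter_upwards [hgood s hs hsP, hε1] with n hn hεn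
    exact iSup_le fun p => (hC n).leakage_le (hK n) (by linarith) (hs n) hσe (hpos (hs n)) hsq
      hn.flat hn.flat_eve p
  · have hlim := hsP.mul tendsto_powerExcess
    rw [mul_one] at hlim
    filter_upwards [hpower s hs hsP C hC, hlim.eventually_lt_const hP'] with n hn hn' m
    exact (hn m).trans (ENNReal.ofReal_le_ofReal hn'.le)
  -- Backing the variance off to `P / powerExcess n` cancels the excess exactly, and it still tends
  -- to `P`.
  · have hs2 (n : ℕ) : √(P / powerExcess n) ^ 2 = P / powerExcess n :=
      Real.sq_sqrt (div_pos hP (powerExcess_pos n)).le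
    have hs (n : ℕ) : 0 < √(P / powerExcess n) :=
      Real.sqrt_pos.2 (div_pos hP (powerExcess_pos n))
    have hlim : Tendsto (fun n => √(P / powerExcess n) ^ 2) atTop (𝓝 P) := by
      simp_rw [hs2]
      have := (tendsto_const_nhds (x := P)).div tendsto_powerExcess one_ne_zero
      rwa [div_one] at this
    refine ⟨fun n => √(P / powerExcess n), hs, hlim, fun C hC => ?_⟩
    filter_upwards [hpower _ hs hlim C hC] with n hn m
    have hm := hn m
    rwa [hs2, div_mul_cancel₀ _ (powerExcess_pos n).ne'] at hm
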